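/- Let $R$ be a commutative noetherian ring, and let $D^b_f(R)$ be the bounded derived category of $R$-complexes with degreewise finitely generated homology. Let $\mathrm{G}$ be the class of finitely generated Gorenstein projective $R$-modules, that is, finitely generated cycle modules of acyclic complexes $P$ of projective $R$-modules such that $\operatorname{Hom}_R(P,Q)$ is acyclic for every projective $R$-module $Q$; modules are viewed as complexes concentrated in degree $0$. The $\mathrm{G}$-level of a complex $M$ in $D^b_f(R)$, denoted $\operatorname{level}_{\mathrm{G}}(M)\in\{0,1,2,\dots,\infty\}$, is defined as follows. It is $0$ if $M\simeq 0$. It is $1$ if $M\not\simeq 0$ and $M$ can be built from modules in $\mathrm{G}$ using shifts, direct summands and finite direct sums. If neither of these applies, it is the least integer $i\ge 2$ for which there is an exact triangle $K\to L\oplus M\to N\to$ with $\operatorname{level}_{\mathrm{G}}(K)=1$ and $\operatorname{level}_{\mathrm{G}}(N)=i-1$. It is $\infty$ if there is no such integer $i$. The Gorenstein dimension $\operatorname{Gdim}(N)$ of a nonzero finitely generated $R$-module $N$ is the least $n\ge 0$ for which there is an exact sequence $0\to G_n\to\cdots\to G_0\to N\to 0$ with all $G_i$ in $\mathrm{G}$,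 and it is $\infty$ if there is no such $n$; moreover $\operatorname{Gdim}(0)=-\infty$. For a complex $M$ write $H(M)^{\oplus}=\bigoplus_{i\in\mathbb{Z}}H_i(M)$ for the direct sum of its homology modules. Then for every $M$ in $D^b_f(R)$, $$\operatorname{level}_{\mathrm{G}}(M)\;\le\;\max\{2,\operatorname{Gdim}(H(M)^{\oplus})+1\}\;=\;\max\{2,\operatorname{level}_{\mathrm{G}}(H(M)^{\oplus})\}.$$ Here the values may be infinite; in particular, the equality asserts that $\operatorname{level}_{\mathrm{G}}(H(M)^{\oplus})=\infty$ if $\operatorname{Gdim}(H(M)^{\oplus})=\infty$. -/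

import Mathlib

universe w u

open CategoryTheory CategoryTheory.Limits

namespace GLevel

section Level

open Pretriangulated

variable {C : Type*} [Category* C] [HasZeroObject C] [HasShift C ℤ] [Preadditive C]
  [∀ n : ℤ, (shiftFunctor C n).Additive] [Pretriangulated C]

/-- The level of `M` with respect to a class `P` of objects of a triangulated category: it is `0`
if `M` is a zero object, and otherwise the least `n + 1` such that `M` lies in
`P.triangEnvelopeIter n`, or `⊤` if there is no such `n`.  Here `P.triangEnvelopeIter 0` consists
of the objects built from `P` using shifts, finite direct sums and direct summands, and
`P.triangEnvelopeIter (n + 1)` consists of the objects `M` for which there is an exact triangle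
`K ⟶ L ⊞ M ⟶ N ⟶` with `K` in `P.triangEnvelopeIter 0` and `N` in `P.triangEnvelopeIter n`
(see `triangEnvelopeIter_succ_iff`). -/
noncomputable def level (P : ObjectProperty C) (M : C) : ℕ∞ :=
  open Classical in
  if IsZero M then 0 else ⨅ (n : ℕ) (_ : P.triangEnvelopeIter n M), ((n + 1 : ℕ) : ℕ∞)

theorem triangEnvelopeIter_succ_iff (P : ObjectProperty C) (n : ℕ) (M : C) :
    P.triangEnvelopeIter (n + 1) M ↔
      ∃ (K L N : C) (f : K ⟶ L ⊞ M) (g : L ⊞ M ⟶ N) (h : N ⟶ K⟦(1 : ℤ)⟧),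
        Triangle.mk f g h ∈ distTriang C ∧
          P.triangEnvelopeIter 0 K ∧ P.triangEnvelopeIter n N := by
  rw [ObjectProperty.triangEnvelopeIter_succ, ← ObjectProperty.triangEnvelopeIter_zero]
  constructor
  · rintro ⟨Y, ⟨K, N, f, g, h, hT, hK, hN⟩, ⟨r⟩⟩
    obtain ⟨Z, p, δ, hT'⟩ := distinguished_cocone_triangle r.i
    have hδ : δ = 0 := by
      have h₁ : δ ≫ r.i⟦(1 : ℤ)⟧' = 0 := comp_distTriang_mor_zero₃₁ _ hT'
      have h₂ : r.i⟦(1 : ℤ)⟧' ≫ r.r⟦(1 : ℤ)⟧' = 𝟙 (M⟦(1 : ℤ)⟧) := by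
        rw [← Functor.map_comp, r.retract, CategoryTheory.Functor.map_id]
      rw [← Category.comp_id δ, ← h₂, ← Category.assoc, h₁, zero_comp]
    obtain ⟨e₀, -⟩ := exists_iso_binaryBiproduct_of_distTriang _ hT' hδ
    let e : Y ≅ Z ⊞ M := e₀ ≪≫ biprod.braiding M Z
    exact ⟨K, Z, N, f ≫ e.hom, e.inv ≫ g, h,
      isomorphic_distinguished _ hT _ (Triangle.isoMk _ _ (Iso.refl _) e.symm (Iso.refl _)
        (show (f ≫ e.hom) ≫ e.inv = 𝟙 K ≫ f by simp)
        (show (e.inv ≫ g) ≫ 𝟙 N = e.inv ≫ g by simp)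
        (show h ≫ (shiftFunctor C (1 : ℤ)).map (𝟙 K) = 𝟙 N ≫ h by simp)), hK, hN⟩
  · rintro ⟨K, L, N, f, g, h, hT, hK, hN⟩
    exact ⟨L ⊞ M, ⟨K, N, f, g, h, hT, hK, hN⟩, ⟨⟨biprod.inr, biprod.snd, by simp⟩⟩⟩

end Level

section Gorenstein

variable {R : Type u} [CommRing R]

/-- A totally acyclic complex of projective modules: an acyclic complex `P` of projective
`R`-modules such that `Hom(P, Q)` is acyclic for every projective `R`-module `Q`. -/
structure IsTotallyAcyclic (P : CochainComplex (ModuleCat.{u} R) ℤ) : Prop where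
  projective (i : ℤ) : Projective (P.X i)
  acyclic : P.Acyclic
  hom_acyclic (Q : ModuleCat.{u} R) (_ : Projective Q) (i : ℤ) (f : P.X i ⟶ Q)
    (_ : P.d (i - 1) i ≫ f = 0) : ∃ g : P.X (i + 1) ⟶ Q, P.d i (i + 1) ≫ g = f

/-- Gorenstein projective modules: the cycle modules of totally acyclic complexes of
projective modules. -/
def IsGorensteinProjective (G : ModuleCat.{u} R) : Prop :=
  ∃ P : CochainComplex (ModuleCat.{u} R) ℤ, IsTotallyAcyclic P ∧ Nonempty (P.cycles 0 ≅ G)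

variable (R) in
/-- The class `G` of finitely generated Gorenstein projective `R`-modules. -/
def fgGorensteinProjective : ObjectProperty (ModuleCat.{u} R) :=
  fun G => Module.Finite R G ∧ IsGorensteinProjective G

/-- `HasGdimLE n N`: there is an exact sequence `0 ⟶ Gₙ ⟶ ⋯ ⟶ G₀ ⟶ N ⟶ 0` with every `Gᵢ` a
finitely generated Gorenstein projective module, given here by the short exact sequences into
which it decomposes. -/
def HasGdimLE : ℕ → ModuleCat.{u} R → Prop
  | 0, N => fgGorensteinProjective R N
  | n + 1, N => ∃ S : ShortComplex (ModuleCat.{u} R), S.ShortExact ∧ Nonempty (S.X₃ ≅ N) ∧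
      fgGorensteinProjective R S.X₂ ∧ HasGdimLE n S.X₁

/-- The Gorenstein dimension of a finitely generated module; it is `⊥` (that is, `-∞`) for the
zero module, and `⊤` for a module without a finite resolution by finitely generated Gorenstein
projective modules. -/
noncomputable def gdim (N : ModuleCat.{u} R) : WithBot ℕ∞ :=
  open Classical in
  if IsZero N then ⊥ else ((⨅ (n : ℕ) (_ : HasGdimLE n N), (n : ℕ∞) : ℕ∞) : WithBot ℕ∞)

end Gorenstein

section Derived

variable {R : Type u} [CommRing R] [HasDerivedCategory.{w} (ModuleCat.{u} R)]

/-- The objects of `D^b_f(R)`: complexes with bounded and degreewise finitely generated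
homology. -/
def IsDbf (M : DerivedCategory (ModuleCat.{u} R)) : Prop :=
  DerivedCategory.TStructure.t.bounded M ∧
    ∀ i : ℤ, Module.Finite R ((DerivedCategory.homologyFunctor (ModuleCat.{u} R) i).obj M)

/-- A module viewed as a complex concentrated in degree `0`. -/
noncomputable abbrev single (N : ModuleCat.{u} R) : DerivedCategory (ModuleCat.{u} R) :=
  (DerivedCategory.singleFunctor (ModuleCat.{u} R) 0).obj N

/-- The `G`-level of a complex: its level with respect to the class of finitely generated
Gorenstein projective modules, viewed as complexes concentrated in degree `0`. -/
noncomputable def gLevel (M : DerivedCategory (ModuleCat.{u} R)) : ℕ∞ :=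
  level ((fgGorensteinProjective R).map (DerivedCategory.singleFunctor (ModuleCat.{u} R) 0)) M

/-- The direct sum `H(M)^⊕` of all the homology modules of `M`. -/
noncomputable def homologySum (M : DerivedCategory (ModuleCat.{u} R)) : ModuleCat.{u} R :=
  ModuleCat.of R
    (DirectSum ℤ fun i => (DerivedCategory.homologyFunctor (ModuleCat.{u} R) i).obj M)

end Derived

end GLevel

/-! Upper bound. After a shift the homology of `M` lies in cohomological degrees `-n, ..., 0`; let
`N` be the top homology and `Y⟦1⟧` the truncation of `M` below it. A surjection from a finitely
generated projective `P` onto `N`, with kernel `B`, lifts to a map `P ⟶ M`, and its fibre `W` is an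
extension of `B` by `Y` (`exists_cover`). Given a triangle `F ⟶ W ⟶ C ⟶` in which `F ⟶ W ⟶ B` is
zero, the fibre of `M ⟶ W⟦1⟧ ⟶ C⟦1⟧` is `P ⊞ F⟦1⟧` (`exists_isTri_biprod`), so such a description of
`W` passes to `M`. By induction on `n`, if all homology has Gorenstein dimension at most `d + 1`,
then `F` can be chosen of level at most 1 and `C` with homology of Gorenstein dimension at most `d`
(`IsFiltered.exists_isTri`); each such reduction costs one level. When the dimension is at most 1,
both outer terms can be chosen of level at most 1 (`IsFiltered.hasSplitting`), which gives level at
most 2. The number 2 is the price of extensions: Gorenstein projective homology alone does not make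
a complex split.

Equality. A resolution shows that the level of a module is at most its Gorenstein dimension plus
one. For the converse the dimension is first shown to be finite: complexes having, after some shift,
a Gorenstein projective truncation form a triangulated class, so a high syzygy of a module of finite
level is a summand of a Gorenstein projective module (`exists_hasGdimLE_of_gIter`). If the dimension
of `N` is `m + 2`, there is a sequence `0 ⟶ K ⟶ G ⟶ N ⟶ 0` with `G` Gorenstein projective and `K` of
projective dimension exactly `m + 1`. The connecting maps of this sequence and of a projective
resolution of `K` are ghosts, since positive `Ext` from Gorenstein projectives into modules of
finite projective dimension vanishes. Their composite is a nonzero product of `m + 2` ghosts, so the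
ghost lemma bounds the level from below (`hasGdimLE_of_gIter`). -/

namespace GLevel

/-! ### Short exact sequences of modules: cokernels, kernels, pushouts, pullbacks. -/

section ShortExactSequences

variable {R : Type u} [CommRing R]

/-- `0 ⟶ A ⟶ B ⟶ D ⟶ 0` is a short exact sequence of modules. -/
structure IsSES {A B D : ModuleCat.{u} R} (f : A ⟶ B) (g : B ⟶ D) : Prop where
  inj : Function.Injective f
  surj : Function.Surjective g
  exact : Function.Exact f g

namespace IsSES

variable {A B D : ModuleCat.{u} R} {f : A ⟶ B} {g : B ⟶ D}

lemma zero (h : IsSES f g) : f ≫ g = 0 := by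
  ext x
  exact h.exact.apply_apply_eq_zero x

lemma zero_apply (h : IsSES f g) (x : A) : g (f x) = 0 := h.exact.apply_apply_eq_zero x

lemma lift (h : IsSES f g) {x : B} (hx : g x = 0) : ∃ a, f a = x := (h.exact x).1 hx

/-- The short complex attached to a short exact sequence. -/
abbrev sc (h : IsSES f g) : ShortComplex (ModuleCat.{u} R) := ShortComplex.mk f g h.zero

lemma shortExact (h : IsSES f g) : h.sc.ShortExact :=
  ModuleCat.shortComplex_shortExact h.sc h.exact h.inj h.surj

end IsSES

lemma _root_.CategoryTheory.ShortComplex.ShortExact.isSES {S : ShortComplex (ModuleCat.{u} R)}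
    (h : S.ShortExact) : IsSES S.f S.g :=
  ⟨h.moduleCat_injective_f, h.moduleCat_surjective_g,
    (ShortComplex.ShortExact.moduleCat_exact_iff_function_exact S).1 h.exact⟩

lemma isSES_mkQ {A B : ModuleCat.{u} R} (f : A ⟶ B) (hf : Function.Injective f) :
    IsSES f (ModuleCat.ofHom (LinearMap.range f.hom).mkQ) where
  inj := hf
  surj := Submodule.mkQ_surjective _
  exact := by
    intro x
    simp

lemma isSES_ker {B D : ModuleCat.{u} R} (g : B ⟶ D) (hg : Function.Surjective g) :
    IsSES (ModuleCat.ofHom (LinearMap.ker g.hom).subtype) g where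
  inj := Subtype.val_injective
  surj := hg
  exact := by
    intro x
    simp

lemma isSES_prod (A B : ModuleCat.{u} R) :
    IsSES (ModuleCat.ofHom (LinearMap.inl R A B) : A ⟶ ModuleCat.of R (A × B))
      (ModuleCat.ofHom (LinearMap.snd R A B)) where
  inj := LinearMap.inl_injective
  surj := LinearMap.snd_surjective
  exact := Function.Exact.inl_snd

lemma isSES_id (A : ModuleCat.{u} R) : IsSES (𝟙 A) (0 : A ⟶ ModuleCat.of R PUnit.{u + 1}) where
  inj := Function.injective_id
  surj := fun _ => ⟨0, rfl⟩
  exact := fun x => ⟨fun _ => ⟨x, rfl⟩, fun _ => rfl⟩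

lemma IsSES.exists_desc {A B D E : ModuleCat.{u} R} {f : A ⟶ B} {g : B ⟶ D} (h : IsSES f g)
    (k : B ⟶ E) (w : f ≫ k = 0) : ∃ l : D ⟶ E, g ≫ l = k := by
  have : Epi h.sc.g := h.shortExact.epi_g
  exact ⟨h.shortExact.exact.desc k w, h.shortExact.exact.g_desc k w⟩

lemma IsSES.exists_lift {A B D E : ModuleCat.{u} R} {f : A ⟶ B} {g : B ⟶ D} (h : IsSES f g)
    (k : E ⟶ B) (w : k ≫ g = 0) : ∃ l : E ⟶ A, l ≫ f = k := by
  have : Mono h.sc.f := h.shortExact.mono_f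
  exact ⟨h.shortExact.exact.lift k w, h.shortExact.exact.lift_f k w⟩

/-- For monomorphisms `A ⟶ B ⟶ D` the cokernels form a short exact sequence. -/
lemma IsSES.exists_cokernels {A B D B' D' E : ModuleCat.{u} R} {f : A ⟶ B} {p : B ⟶ B'}
    {g : B ⟶ D} {q : D ⟶ D'} {r : D ⟶ E} (h₁ : IsSES f p) (h₂ : IsSES g q)
    (h₃ : IsSES (f ≫ g) r) :
    ∃ (a : B' ⟶ E) (b : E ⟶ D'), IsSES a b ∧ p ≫ a = g ≫ r := by
  obtain ⟨a, ha⟩ := h₁.exists_desc (g ≫ r) (by simpa using h₃.zero)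
  obtain ⟨b, hb⟩ := h₃.exists_desc q (by rw [Category.assoc, h₂.zero, comp_zero])
  replace ha : ∀ x, a (p x) = r (g x) := fun x => congr($ha x)
  replace hb : ∀ x, b (r x) = q x := fun x => congr($hb x)
  refine ⟨a, b, ⟨?_, ?_, ?_⟩, by ext x; exact ha x⟩
  · rw [injective_iff_map_eq_zero]
    intro x hx
    obtain ⟨y, rfl⟩ := h₁.surj x
    rw [ha] at hx
    obtain ⟨z, hz⟩ := h₃.lift hx
    obtain rfl : f z = y := h₂.inj hz
    exact h₁.zero_apply z
  · intro x
    obtain ⟨y, rfl⟩ := h₂.surj x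
    exact ⟨r y, hb y⟩
  · intro x
    constructor
    · intro hx
      obtain ⟨y, rfl⟩ := h₃.surj x
      rw [hb] at hx
      obtain ⟨z, rfl⟩ := h₂.lift hx
      exact ⟨p z, ha z⟩
    · rintro ⟨y, rfl⟩
      obtain ⟨z, rfl⟩ := h₁.surj y
      rw [ha, hb, h₂.zero_apply]

/-- For epimorphisms `A ⟶ B ⟶ D` the kernels form a short exact sequence. -/
lemma IsSES.exists_kernels {A B D K L N : ModuleCat.{u} R} {i : K ⟶ A} {f : A ⟶ B}
    {j : L ⟶ B} {g : B ⟶ D} {k : N ⟶ A} (h₁ : IsSES i f) (h₂ : IsSES j g)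
    (h₃ : IsSES k (f ≫ g)) :
    ∃ (a : K ⟶ N) (b : N ⟶ L), IsSES a b := by
  obtain ⟨a, ha⟩ := h₃.exists_lift i (by rw [← Category.assoc, h₁.zero, zero_comp])
  obtain ⟨b, hb⟩ := h₂.exists_lift (k ≫ f) (by simpa using h₃.zero)
  replace ha : ∀ x, k (a x) = i x := fun x => congr($ha x)
  replace hb : ∀ x, j (b x) = f (k x) := fun x => congr($hb x)
  refine ⟨a, b, ⟨?_, ?_, ?_⟩⟩
  · intro x y hxy
    apply h₁.inj
    rw [← ha, ← ha, hxy]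
  · intro x
    obtain ⟨y, hy⟩ := h₁.surj (j x)
    obtain ⟨z, rfl⟩ := h₃.lift (x := y) (by
      change g (f y) = 0
      rw [hy, h₂.zero_apply])
    exact ⟨z, h₂.inj (by rw [hb, hy])⟩
  · intro x
    constructor
    · intro hx
      obtain ⟨y, hy⟩ := h₁.lift (x := k x) (by rw [← hb, hx, map_zero])
      exact ⟨y, h₃.inj (by rw [ha, hy])⟩
    · rintro ⟨y, rfl⟩
      exact h₂.inj (by rw [hb, ha, h₁.zero_apply, map_zero])

/-- The pushout of a short exact sequence along a monomorphism. -/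
lemma IsSES.exists_pushout {A B D A' A'' : ModuleCat.{u} R} {f : A ⟶ B} {g : B ⟶ D}
    {i : A ⟶ A'} {p : A' ⟶ A''} (h₁ : IsSES f g) (h₂ : IsSES i p) :
    ∃ (W : ModuleCat.{u} R) (f' : A' ⟶ W) (g' : W ⟶ D) (i' : B ⟶ W) (p' : W ⟶ A''),
      IsSES f' g' ∧ IsSES i' p' ∧ f ≫ i' = i ≫ f' ∧ f' ≫ p' = p ∧ i' ≫ g' = g := by
  let s : A ⟶ ModuleCat.of R (B × A') := ModuleCat.ofHom (LinearMap.prod f.hom (-i.hom))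
  have hs := isSES_mkQ s (fun x y hxy => h₁.inj (congr_arg Prod.fst hxy))
  set r := ModuleCat.ofHom (LinearMap.range s.hom).mkQ
  let l₁ : B ⟶ ModuleCat.of R (B × A') := ModuleCat.ofHom (LinearMap.inl R B A')
  let l₂ : A' ⟶ ModuleCat.of R (B × A') := ModuleCat.ofHom (LinearMap.inr R B A')
  obtain ⟨g', hg'⟩ := hs.exists_desc (ModuleCat.ofHom (g.hom ∘ₗ LinearMap.fst R B A')) (by
    ext x
    exact h₁.zero_apply x)
  obtain ⟨p', hp'⟩ := hs.exists_desc (ModuleCat.ofHom (p.hom ∘ₗ LinearMap.snd R B A')) (by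
    ext x
    change p (-(i x)) = 0
    rw [map_neg, h₂.zero_apply, neg_zero])
  have comm : f ≫ l₁ ≫ r = i ≫ l₂ ≫ r := by
    have : s ≫ r = f ≫ l₁ ≫ r - i ≫ l₂ ≫ r := by
      rw [← Category.assoc, ← Category.assoc, ← Preadditive.sub_comp]
      congr 1
      ext x
      · change f x = f x - 0
        rw [sub_zero]
      · change -i x = 0 - i x
        rw [zero_sub]
    rw [hs.zero] at this
    exact (sub_eq_zero.1 this.symm)
  have eg : ∀ b a, g' (r (b, a)) = g b := fun b a => congr($hg' (b, a))
  have ep : ∀ b a, p' (r (b, a)) = p a := fun b a => congr($hp' (b, a))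
  refine ⟨_, l₂ ≫ r, g', l₁ ≫ r, p', ⟨?_, ?_, ?_⟩, ⟨?_, ?_, ?_⟩, comm, ?_, ?_⟩
  · rw [injective_iff_map_eq_zero]
    intro x hx
    obtain ⟨y, hy⟩ := hs.lift (x := ((0, x) : B × A')) hx
    have h₁' : f y = 0 := congr_arg Prod.fst hy
    have h₂' : -i y = x := congr_arg Prod.snd hy
    obtain rfl : y = 0 := h₁.inj (by rw [h₁', map_zero])
    simpa using h₂'.symm
  · intro x
    obtain ⟨y, rfl⟩ := h₁.surj x
    exact ⟨r (y, 0), eg y 0⟩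
  · intro x
    constructor
    · intro hx
      obtain ⟨⟨b, a⟩, rfl⟩ := hs.surj x
      rw [eg] at hx
      obtain ⟨y, rfl⟩ := h₁.lift hx
      refine ⟨i y + a, ?_⟩
      have := congr($comm y)
      change r (f y, 0) = r (0, i y) at this
      change r (0, i y + a) = _
      rw [show ((0, i y + a) : B × A') = (0, i y) + (0, a) by simp, map_add, ← this, ← map_add]
      simp
    · rintro ⟨y, rfl⟩
      exact (eg 0 y).trans (map_zero _)
  · rw [injective_iff_map_eq_zero]
    intro x hx
    obtain ⟨y, hy⟩ := hs.lift (x := ((x, 0) : B × A')) hx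
    have h₁' : f y = x := congr_arg Prod.fst hy
    have h₂' : -i y = 0 := congr_arg Prod.snd hy
    obtain rfl : y = 0 := h₂.inj (by simpa using h₂')
    simpa using h₁'.symm
  · intro x
    obtain ⟨y, rfl⟩ := h₂.surj x
    exact ⟨r (0, y), ep 0 y⟩
  · intro x
    constructor
    · intro hx
      obtain ⟨⟨b, a⟩, rfl⟩ := hs.surj x
      rw [ep] at hx
      obtain ⟨y, rfl⟩ := h₂.lift hx
      refine ⟨b + f y, ?_⟩
      have := congr($comm y)
      change r (f y, 0) = r (0, i y) at this
      change r (b + f y, 0) = _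
      rw [show ((b + f y, 0) : B × A') = (b, 0) + (f y, 0) by simp, map_add, this, ← map_add]
      simp
    · rintro ⟨y, rfl⟩
      exact (ep y 0).trans (map_zero _)
  · ext x
    exact ep 0 x
  · ext x
    exact eg x 0

/-- The pullback of a short exact sequence along an epimorphism. -/
lemma IsSES.exists_pullback {A B D K D' : ModuleCat.{u} R} {f : A ⟶ B} {g : B ⟶ D}
    {k : K ⟶ D'} {q : D' ⟶ D} (h₁ : IsSES f g) (h₂ : IsSES k q) :
    ∃ (X : ModuleCat.{u} R) (f' : A ⟶ X) (g' : X ⟶ D') (k' : K ⟶ X) (q' : X ⟶ B),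
      IsSES f' g' ∧ IsSES k' q' := by
  let t : ModuleCat.of R (B × D') ⟶ D :=
    ModuleCat.ofHom (g.hom ∘ₗ LinearMap.fst R B D' - q.hom ∘ₗ LinearMap.snd R B D')
  have ht : ∀ b d, t (b, d) = g b - q d := fun _ _ => rfl
  let X : ModuleCat.{u} R := ModuleCat.of R (LinearMap.ker t.hom)
  let f' : A ⟶ X := ModuleCat.ofHom ((LinearMap.inl R B D' ∘ₗ f.hom).codRestrict _ (by
    intro x
    change g (f x) - q 0 = 0
    rw [h₁.zero_apply, map_zero, sub_zero]))
  let k' : K ⟶ X := ModuleCat.ofHom ((LinearMap.inr R B D' ∘ₗ k.hom).codRestrict _ (by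
    intro x
    change g 0 - q (k x) = 0
    rw [h₂.zero_apply, map_zero, sub_zero]))
  refine ⟨X, f', ModuleCat.ofHom (LinearMap.snd R B D' ∘ₗ (LinearMap.ker t.hom).subtype), k',
    ModuleCat.ofHom (LinearMap.fst R B D' ∘ₗ (LinearMap.ker t.hom).subtype),
    ⟨?_, ?_, ?_⟩, ⟨?_, ?_, ?_⟩⟩
  · intro x y hxy
    exact h₁.inj (congr_arg (fun z : X => z.1.1) hxy)
  · intro x
    obtain ⟨y, hy⟩ := h₁.surj (q x)
    exact ⟨⟨(y, x), by change g y - q x = 0; rw [hy, sub_self]⟩, rfl⟩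
  · rintro ⟨⟨b, d⟩, hx⟩
    constructor
    · rintro (rfl : d = 0)
      have : g b - q 0 = 0 := hx
      rw [map_zero, sub_zero] at this
      obtain ⟨y, rfl⟩ := h₁.lift this
      exact ⟨y, rfl⟩
    · rintro ⟨y, hy⟩
      exact (congr_arg (fun z : X => z.1.2) hy).symm
  · intro x y hxy
    exact h₂.inj (congr_arg (fun z : X => z.1.2) hxy)
  · intro x
    obtain ⟨y, hy⟩ := h₂.surj (g x)
    exact ⟨⟨(x, y), by change g x - q y = 0; rw [hy, sub_self]⟩, rfl⟩
  · rintro ⟨⟨b, d⟩, hx⟩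
    constructor
    · rintro (rfl : b = 0)
      have : g 0 - q d = 0 := hx
      rw [map_zero, zero_sub, neg_eq_zero] at this
      obtain ⟨y, rfl⟩ := h₂.lift this
      exact ⟨y, rfl⟩
    · rintro ⟨y, hy⟩
      exact (congr_arg (fun z : X => z.1.1) hy).symm

/-- A short exact sequence whose epimorphism has a section is split. -/
lemma IsSES.iso_prod {A B D : ModuleCat.{u} R} {f : A ⟶ B} {g : B ⟶ D} (h : IsSES f g)
    (s : D ⟶ B) (hs : s ≫ g = 𝟙 D) : Nonempty (B ≅ ModuleCat.of R (A × D)) := by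
  replace hs : ∀ x, g (s x) = x := fun x => congr($hs x)
  refine ⟨(LinearEquiv.toModuleIso (X₁ := A × D) (X₂ := B) (LinearEquiv.ofBijective
    (LinearMap.coprod f.hom s.hom) ⟨?_, ?_⟩)).symm⟩
  · rw [injective_iff_map_eq_zero]
    rintro ⟨a, d⟩ (had : f a + s d = 0)
    have h₁ := congr_arg g had
    rw [map_add, h.zero_apply, hs, map_zero, zero_add] at h₁
    subst h₁
    rw [map_zero, add_zero] at had
    obtain rfl : a = 0 := h.inj (by rw [had, map_zero])
    rfl
  · intro b
    obtain ⟨a, ha⟩ := h.lift (x := b - s (g b)) (by rw [map_sub, hs, sub_self])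
    refine ⟨(a, g b), ?_⟩
    change f a + s (g b) = b
    rw [ha, sub_add_cancel]

lemma IsSES.prod {A B D A' B' D' : ModuleCat.{u} R} {f : A ⟶ B} {g : B ⟶ D} {f' : A' ⟶ B'}
    {g' : B' ⟶ D'} (h : IsSES f g) (h' : IsSES f' g') :
    IsSES (A := ModuleCat.of R (A × A')) (B := ModuleCat.of R (B × B'))
      (D := ModuleCat.of R (D × D')) (ModuleCat.ofHom (LinearMap.prodMap f.hom f'.hom))
      (ModuleCat.ofHom (LinearMap.prodMap g.hom g'.hom)) where
  inj := by
    rintro ⟨x, y⟩ ⟨x', y'⟩ hxy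
    exact Prod.ext (h.inj (congr_arg Prod.fst hxy)) (h'.inj (congr_arg Prod.snd hxy))
  surj := by
    rintro ⟨x, y⟩
    obtain ⟨a, rfl⟩ := h.surj x
    obtain ⟨b, rfl⟩ := h'.surj y
    exact ⟨(a, b), rfl⟩
  exact := by
    rintro ⟨x, y⟩
    constructor
    · intro hxy
      obtain ⟨a, rfl⟩ := h.lift (x := x) (congr_arg Prod.fst hxy)
      obtain ⟨b, rfl⟩ := h'.lift (x := y) (congr_arg Prod.snd hxy)
      exact ⟨(a, b), rfl⟩
    · rintro ⟨⟨a, b⟩, hab⟩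
      rw [← hab]
      exact Prod.ext (h.zero_apply a) (h'.zero_apply b)

lemma IsSES.iso_comp {A B D A' D' : ModuleCat.{u} R} {f : A ⟶ B} {g : B ⟶ D} (h : IsSES f g)
    (e : A' ≅ A) (e' : D ≅ D') : IsSES (e.hom ≫ f) (g ≫ e'.hom) where
  inj := h.inj.comp (ConcreteCategory.bijective_of_isIso e.hom).1
  surj := (ConcreteCategory.bijective_of_isIso e'.hom).2.comp h.surj
  exact := by
    intro x
    constructor
    · intro hx
      obtain ⟨a, rfl⟩ := h.lift (x := x) ((ConcreteCategory.bijective_of_isIso e'.hom).1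
        (hx.trans (map_zero _).symm))
      obtain ⟨b, rfl⟩ := (ConcreteCategory.bijective_of_isIso e.hom).2 a
      exact ⟨b, rfl⟩
    · rintro ⟨y, rfl⟩
      change e'.hom (g (f (e.hom y))) = 0
      rw [h.zero_apply, map_zero]

lemma exists_isSES_of_projective (X : ModuleCat.{u} R) :
    ∃ (K P : ModuleCat.{u} R) (k : K ⟶ P) (p : P ⟶ X), Projective P ∧ IsSES k p :=
  ⟨_, Projective.over X, _, Projective.π X, inferInstance,
    isSES_ker _ ((ModuleCat.epi_iff_surjective _).1 (Projective.π_epi X))⟩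

lemma exists_isSES_of_finite [IsNoetherianRing R] (X : ModuleCat.{u} R) [Module.Finite R X] :
    ∃ (K P : ModuleCat.{u} R) (k : K ⟶ P) (p : P ⟶ X),
      Projective P ∧ Module.Finite R P ∧ Module.Finite R K ∧ IsSES k p := by
  obtain ⟨n, f, hf⟩ := Module.Finite.exists_fin' R X
  refine ⟨ModuleCat.of R (LinearMap.ker f), ModuleCat.of R (Fin n → R),
    ModuleCat.ofHom (LinearMap.ker f).subtype, ModuleCat.ofHom f, ?_, ?_, ?_,
    isSES_ker (B := ModuleCat.of R (Fin n → R)) (ModuleCat.ofHom f) hf⟩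
  · exact (IsProjective.iff_projective (R := R) (Fin n → R)).1 inferInstance
  · change Module.Finite R (Fin n → R)
    infer_instance
  · change Module.Finite R (LinearMap.ker f)
    infer_instance

end ShortExactSequences

/-! ### Gorenstein projective modules described coinductively. -/

section GorensteinProjective

open Abelian

variable {R : Type u} [CommRing R]

/-- `Ext^i(X, Q) = 0` for all `i > 0` and all projective `Q`. -/
def ExtVanish (X : ModuleCat.{u} R) : Prop :=
  ∀ (Q : ModuleCat.{u} R) (_ : Projective Q) (n : ℕ) (e : Ext.{u} X Q (n + 1)), e = 0

namespace ExtVanish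

variable {A B D : ModuleCat.{u} R} {f : A ⟶ B} {g : B ⟶ D}

lemma of_projective (P : ModuleCat.{u} R) [Projective P] : ExtVanish P :=
  fun _ _ _ e => Ext.eq_zero_of_projective e

lemma mid (h : IsSES f g) (hA : ExtVanish A) (hD : ExtVanish D) : ExtVanish B := by
  intro Q hQ n e
  obtain ⟨x, rfl⟩ := Ext.contravariant_sequence_exact₂ h.shortExact Q e (hA Q hQ n _)
  rw [hD Q hQ n x, Ext.comp_zero]

lemma left (h : IsSES f g) (hB : ExtVanish B) (hD : ExtVanish D) : ExtVanish A := by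
  intro Q hQ n e
  obtain ⟨x, rfl⟩ := Ext.contravariant_sequence_exact₁ h.shortExact Q e
    (add_comm 1 (n + 1)) (hD Q hQ (n + 1) _)
  rw [hB Q hQ n x, Ext.comp_zero]

/-- The obstruction to extending `k` lies in `Ext¹(D, Q) = 0`. -/
lemma extend (h : IsSES f g) (hD : ExtVanish D) {Q : ModuleCat.{u} R} (hQ : Projective Q)
    (k : A ⟶ Q) : ∃ l : B ⟶ Q, f ≫ l = k := by
  obtain ⟨x, hx⟩ := Ext.contravariant_sequence_exact₁ h.shortExact Q (Ext.mk₀ k)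
    (add_zero 1) (hD Q hQ 0 _)
  obtain ⟨l, rfl⟩ := Ext.addEquiv₀.symm.surjective x
  refine ⟨l, ?_⟩
  rw [Ext.addEquiv₀_symm_apply, Ext.mk₀_comp_mk₀] at hx
  exact (Ext.mk₀_bijective _ _).1 hx

lemma of_retract {X Y : ModuleCat.{u} R} (i : X ⟶ Y) (r : Y ⟶ X) (hir : i ≫ r = 𝟙 X)
    (hY : ExtVanish Y) : ExtVanish X := by
  intro Q hQ n e
  rw [← Ext.mk₀_id_comp e, ← hir, ← Ext.mk₀_comp_mk₀_assoc, hY Q hQ n ((Ext.mk₀ r).comp e _),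
    Ext.comp_zero]

end ExtVanish

/-- Classes of modules with vanishing `Ext` into projective modules, in which every module
embeds into a projective module with cokernel in the class. -/
structure IsGPClass (𝒳 : ObjectProperty (ModuleCat.{u} R)) : Prop where
  ext (X : ModuleCat.{u} R) (_ : 𝒳 X) : ExtVanish X
  embed (X : ModuleCat.{u} R) (_ : 𝒳 X) : ∃ (P Y : ModuleCat.{u} R) (f : X ⟶ P) (g : P ⟶ Y),
    IsSES f g ∧ Projective P ∧ 𝒳 Y

/-- Modules that belong to a class as in `IsGPClass`. -/
def IsGP (X : ModuleCat.{u} R) : Prop := ∃ 𝒳 : ObjectProperty (ModuleCat.{u} R), IsGPClass 𝒳 ∧ 𝒳 X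

namespace IsGP

variable {A B D X Y : ModuleCat.{u} R} {f : A ⟶ B} {g : B ⟶ D}

lemma ext (h : IsGP X) : ExtVanish X := by
  obtain ⟨𝒳, h𝒳, hX⟩ := h
  exact h𝒳.ext X hX

lemma embed (h : IsGP X) : ∃ (P Y : ModuleCat.{u} R) (f : X ⟶ P) (g : P ⟶ Y),
    IsSES f g ∧ Projective P ∧ IsGP Y := by
  obtain ⟨𝒳, h𝒳, hX⟩ := h
  obtain ⟨P, Y, f, g, h, hP, hY⟩ := h𝒳.embed X hX
  exact ⟨P, Y, f, g, h, hP, 𝒳, h𝒳, hY⟩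

/-- Closure properties of `IsGP` are coinductive: it suffices to exhibit one class that contains the
module and meets the two conditions of `IsGPClass`. This pattern recurs below. -/
lemma of_iso (e : X ≅ Y) (h : IsGP X) : IsGP Y := by
  refine ⟨fun Y => ∃ X, Nonempty (X ≅ Y) ∧ IsGP X, ⟨?_, ?_⟩, X, ⟨e⟩, h⟩
  · rintro Y ⟨X, ⟨e⟩, h⟩
    exact h.ext.of_retract e.inv e.hom e.inv_hom_id
  · rintro Y ⟨X, ⟨e⟩, h⟩
    obtain ⟨P, Z, f, g, h, hP, hZ⟩ := h.embed
    exact ⟨P, Z, _, _, h.iso_comp e.symm (Iso.refl Z), hP, Z, ⟨Iso.refl Z⟩, hZ⟩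

lemma of_projective (P : ModuleCat.{u} R) [Projective P] : IsGP P := by
  refine ⟨fun P => Projective P, ⟨?_, ?_⟩, inferInstance⟩
  · intro X _
    exact ExtVanish.of_projective X
  · intro X hX
    refine ⟨X, _, _, _, isSES_id X, hX, ?_⟩
    exact (IsProjective.iff_projective (R := R) PUnit.{u + 1}).1 inferInstance

lemma projective_prod (P Q : ModuleCat.{u} R) [hP : Projective P] [hQ : Projective Q] :
    Projective (ModuleCat.of R (P × Q)) := by
  have := (IsProjective.iff_projective (R := R) P).2 hP
  have := (IsProjective.iff_projective (R := R) Q).2 hQ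
  exact (IsProjective.iff_projective (R := R) (P × Q)).1 inferInstance

/-- A horseshoe argument: `A ⟶ P` extends to `B` because `Ext¹(D, P) = 0`, so `B` embeds into `P ×
Q` with cokernel an extension of `Z` by `X`. -/
lemma mid (h : IsSES f g) (hA : IsGP A) (hD : IsGP D) : IsGP B := by
  refine ⟨fun B => ∃ (A D : ModuleCat.{u} R) (f : A ⟶ B) (g : B ⟶ D), IsSES f g ∧ IsGP A ∧ IsGP D,
    ⟨?_, ?_⟩, A, D, f, g, h, hA, hD⟩
  · rintro B ⟨A, D, f, g, h, hA, hD⟩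
    exact .mid h hA.ext hD.ext
  · rintro B ⟨A, D, f, g, h, hA, hD⟩
    obtain ⟨P, X, i, p, hi, hP, hX⟩ := hA.embed
    obtain ⟨Q, Z, j, q, hj, hQ, hZ⟩ := hD.embed
    -- The pushout `W` is an extension of `D` by `P`; the retraction `l` splits it, and `W` then
    -- embeds into `P × Q` with cokernel `Z`.
    obtain ⟨W, f', g', i', p', h₁, h₂, -, -, hg⟩ := h.exists_pushout hi
    obtain ⟨l, hl⟩ := hD.ext.extend h₁ hP (𝟙 P)
    have hT : IsSES (A := W) (B := ModuleCat.of R (P × Q))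
        (ModuleCat.ofHom (l.hom.prod (g' ≫ j).hom))
        (ModuleCat.ofHom (q.hom ∘ₗ LinearMap.snd R P Q)) := by
      replace hl : ∀ x, l (f' x) = x := fun x => congr($hl x)
      refine ⟨?_, hj.surj.comp LinearMap.snd_surjective, ?_⟩
      · rw [injective_iff_map_eq_zero]
        intro x hx
        have e₁ : l x = 0 := congr_arg Prod.fst hx
        have e₂ : j (g' x) = 0 := congr_arg Prod.snd hx
        have e₃ : g' x = 0 := hj.inj (by rw [e₂, map_zero])
        obtain ⟨y, rfl⟩ := h₁.lift e₃
        rw [hl] at e₁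
        rw [e₁, map_zero]
      · rintro ⟨a, b⟩
        constructor
        · intro hx
          obtain ⟨c, rfl⟩ := hj.lift (x := b) hx
          obtain ⟨w, rfl⟩ := h₁.surj c
          refine ⟨f' (a - l w) + w, Prod.ext ?_ ?_⟩
          · change l (f' (a - l w) + w) = a
            rw [map_add, hl, sub_add_cancel]
          · change j (g' (f' (a - l w) + w)) = j (g' w)
            rw [map_add, h₁.zero_apply, zero_add]
        · rintro ⟨w, hw⟩
          rw [← hw]
          exact hj.zero_apply _
    set T : W ⟶ ModuleCat.of R (P × Q) := ModuleCat.ofHom (l.hom.prod (g' ≫ j).hom)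
    have hc := isSES_mkQ (i' ≫ T) (hT.inj.comp h₂.inj)
    obtain ⟨a, b, hab, -⟩ := h₂.exists_cokernels hT hc
    exact ⟨_, _, _, _, hc, projective_prod P Q, _, _, a, b, hab, hX, hZ⟩

lemma prod (hA : IsGP A) (hB : IsGP B) : IsGP (ModuleCat.of R (A × B)) :=
  mid (isSES_prod A B) hA hB

/-- Embed `A` through `B` into `P`: the cokernel is an extension of `P / B` by `D`. Since it
satisfies `IsGP`, one step suffices to enter a suitable class. -/
lemma left (h : IsSES f g) (hB : IsGP B) (hD : IsGP D) : IsGP A := by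
  refine ⟨fun A => ExtVanish A ∧ ∃ (P Y : ModuleCat.{u} R) (f : A ⟶ P) (g : P ⟶ Y), IsSES f g ∧
    Projective P ∧ IsGP Y, ⟨fun _ h => h.1, ?_⟩, ?_⟩
  · rintro X ⟨-, P, Y, f, g, h, hP, hY⟩
    obtain ⟨Q, Z, f', g', h', hQ, hZ⟩ := hY.embed
    exact ⟨P, Y, f, g, h, hP, hY.ext, Q, Z, f', g', h', hQ, hZ⟩
  · refine ⟨.left h hB.ext hD.ext, ?_⟩
    obtain ⟨P, Y, i, p, h', hP, hY⟩ := hB.embed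
    have hc := isSES_mkQ (f ≫ i) (h'.inj.comp h.inj)
    obtain ⟨a, b, hab, -⟩ := h.exists_cokernels h' hc
    exact ⟨_, _, _, _, hc, hP, mid hab hD hY⟩

/-- With `A × B ⊆ P`, the complement of `P / A` is `P / B`: their product is an extension of two
copies of `P / (A × B)` by `A × B`, hence again satisfies `IsGP`. -/
lemma of_prod (h : IsGP (ModuleCat.of R (A × B))) : IsGP A := by
  refine ⟨fun A => ∃ B : ModuleCat.{u} R, IsGP (ModuleCat.of R (A × B)), ⟨?_, ?_⟩, B, h⟩
  · rintro A ⟨B, h⟩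
    exact h.ext.of_retract (ModuleCat.ofHom (LinearMap.inl R A B))
      (ModuleCat.ofHom (LinearMap.fst R A B)) rfl
  · rintro A ⟨B, h⟩
    obtain ⟨P, X, i, p, hi, hP, hX⟩ := h.embed
    have h₁ := isSES_mkQ (ModuleCat.ofHom (LinearMap.inl R A B) ≫ i)
      (hi.inj.comp LinearMap.inl_injective)
    have h₂ := isSES_mkQ (ModuleCat.ofHom (LinearMap.inr R A B) ≫ i)
      (hi.inj.comp LinearMap.inr_injective)
    have h₃ := h₁.prod h₂
    let θ : ModuleCat.of R (A × B) ⟶ ModuleCat.of R ((A × B) × (A × B)) :=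
      ModuleCat.ofHom ((LinearMap.inl R A B ∘ₗ LinearMap.fst R A B).prod
        (LinearMap.inr R A B ∘ₗ LinearMap.snd R A B))
    have hθ : IsSES θ (D := ModuleCat.of R (A × B)) (ModuleCat.ofHom
        ((LinearMap.fst R A B ∘ₗ LinearMap.snd R (A × B) (A × B)).prod
          (LinearMap.snd R A B ∘ₗ LinearMap.fst R (A × B) (A × B)))) := by
      refine ⟨?_, ?_, ?_⟩
      · rintro ⟨x, y⟩ ⟨x', y'⟩ hxy
        exact Prod.ext (congr_arg (fun z : (A × B) × (A × B) => z.1.1) hxy)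
          (congr_arg (fun z : (A × B) × (A × B) => z.2.2) hxy)
      · rintro ⟨x, y⟩
        exact ⟨((0, y), (x, 0)), rfl⟩
      · rintro ⟨⟨x, y⟩, ⟨x', y'⟩⟩
        constructor
        · intro hx
          obtain rfl : x' = 0 := congr_arg Prod.fst hx
          obtain rfl : y = 0 := congr_arg Prod.snd hx
          exact ⟨(x, y'), rfl⟩
        · rintro ⟨⟨a, b⟩, hab⟩
          rw [← hab]
          rfl
    obtain ⟨a, b, hab, -⟩ := hθ.exists_cokernels (hi.prod hi) h₃
    exact ⟨P, _, _, _, h₁, hP, _, mid hab h (hX.prod hX)⟩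

lemma of_retract (i : X ⟶ Y) (r : Y ⟶ X) (hir : i ≫ r = 𝟙 X) (hY : IsGP Y) : IsGP X := by
  have h := isSES_ker r (fun x => ⟨i x, congr($hir x)⟩)
  obtain ⟨e⟩ := h.iso_prod i hir
  exact of_prod (hY.of_iso (e ≪≫ (LinearEquiv.prodComm R _ _).toModuleIso))

end IsGP

end GorensteinProjective

/-! ### Agreement of the coinductive description with total acyclicity. -/

section TotallyAcyclic

open Abelian

variable {R : Type u} [CommRing R]

lemma IsTotallyAcyclic.isSES_cycles {P : CochainComplex (ModuleCat.{u} R) ℤ}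
    (hP : IsTotallyAcyclic P) (i : ℤ) :
    IsSES (P.iCycles i) (P.toCycles i (i + 1)) := by
  have hk : (ShortComplex.mk (P.iCycles i) (P.d i (i + 1)) (P.iCycles_d i (i + 1))).Exact :=
    ShortComplex.exact_of_f_is_kernel _ (P.cyclesIsKernel i (i + 1) (by simp))
  have hk' := (ShortComplex.ShortExact.moduleCat_exact_iff_function_exact _).1 hk
  have he := hP.acyclic (i + 1)
  rw [HomologicalComplex.exactAt_iff' P i (i + 1) (i + 1 + 1) (by simp) (by simp)] at he
  have he' := (ShortComplex.ShortExact.moduleCat_exact_iff_function_exact _).1 he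
  have hinj : ∀ j, Function.Injective (P.iCycles j) :=
    fun j => (ModuleCat.mono_iff_injective _).1 inferInstance
  have hi : ∀ x, P.iCycles (i + 1) (P.toCycles i (i + 1) x) = P.d i (i + 1) x :=
    fun x => congr($(P.toCycles_i i (i + 1)) x)
  refine ⟨hinj i, ?_, ?_⟩
  · intro y
    obtain ⟨x, hx⟩ := (he' (P.iCycles (i + 1) y)).1
      (congr($(P.iCycles_d (i + 1) (i + 1 + 1)) y))
    exact ⟨x, hinj _ ((hi x).trans hx)⟩
  · intro x
    rw [← hk' x]
    constructor
    · intro hx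
      change P.d i (i + 1) x = 0
      rw [← hi, hx, map_zero]
    · intro hx
      exact hinj _ (((hi x).trans hx).trans (map_zero _).symm)

/-- Composed with the surjection from the preceding term, `f` becomes a cocycle of `Hom(P, Q)`,
hence a coboundary. -/
lemma IsTotallyAcyclic.extend {P : CochainComplex (ModuleCat.{u} R) ℤ}
    (hP : IsTotallyAcyclic P) (i : ℤ) (Q : ModuleCat.{u} R) (hQ : Projective Q)
    (f : P.cycles i ⟶ Q) : ∃ g : P.X i ⟶ Q, P.iCycles i ≫ g = f := by
  obtain ⟨j, rfl⟩ : ∃ j, i = j + 1 := ⟨i - 1, by lia⟩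
  obtain ⟨g, hg⟩ := hP.hom_acyclic Q hQ j (P.toCycles j (j + 1) ≫ f) (by
    rw [← Category.assoc, P.d_toCycles, zero_comp])
  have : Epi (P.toCycles j (j + 1)) :=
    (ModuleCat.epi_iff_surjective _).2 (hP.isSES_cycles j).surj
  refine ⟨g, ?_⟩
  rw [← cancel_epi (P.toCycles j (j + 1)), ← Category.assoc, P.toCycles_i, hg]

/-- Dimension shifting along the cycle sequences reduces to `Ext¹`, which vanishes because maps from
cycles to projectives extend. -/
lemma IsTotallyAcyclic.extVanish_cycles {P : CochainComplex (ModuleCat.{u} R) ℤ}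
    (hP : IsTotallyAcyclic P) (i : ℤ) : ExtVanish (P.cycles i) := by
  intro Q hQ n
  induction n generalizing i with
  | zero =>
    intro e
    obtain ⟨j, rfl⟩ : ∃ j, i = j + 1 := ⟨i - 1, by lia⟩
    have hPj := hP.projective j
    obtain ⟨x, rfl⟩ := Ext.contravariant_sequence_exact₃ (hP.isSES_cycles j).shortExact Q e
      (Ext.eq_zero_of_projective (P := P.X j) _) (add_zero 1)
    obtain ⟨k, rfl⟩ := Ext.addEquiv₀.symm.surjective x
    obtain ⟨l, hl⟩ := hP.extend j Q hQ k
    rw [Ext.addEquiv₀_symm_apply, ← hl, ← Ext.mk₀_comp_mk₀]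
    exact ShortComplex.ShortExact.extClass_comp_assoc _ _
  | succ n ih =>
    intro e
    obtain ⟨j, rfl⟩ : ∃ j, i = j + 1 := ⟨i - 1, by lia⟩
    have hPj := hP.projective j
    obtain ⟨x, rfl⟩ := Ext.contravariant_sequence_exact₃ (hP.isSES_cycles j).shortExact Q e
      (Ext.eq_zero_of_projective (P := P.X j) _) (add_comm 1 (n + 1))
    rw [ih j x, Ext.comp_zero]

lemma IsGorensteinProjective.isGP {X : ModuleCat.{u} R} (h : IsGorensteinProjective X) :
    IsGP X := by
  obtain ⟨P, hP, ⟨e⟩⟩ := h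
  refine .of_iso e ⟨fun X => ∃ (P : CochainComplex (ModuleCat.{u} R) ℤ) (i : ℤ),
    IsTotallyAcyclic P ∧ P.cycles i = X, ⟨?_, ?_⟩, P, 0, hP, rfl⟩
  · rintro _ ⟨P, i, hP, rfl⟩
    exact hP.extVanish_cycles i
  · rintro _ ⟨P, i, hP, rfl⟩
    exact ⟨P.X i, P.cycles (i + 1), _, _, hP.isSES_cycles i, hP.projective i, P, i + 1, hP, rfl⟩

lemma IsGP.exists_prev {X : ModuleCat.{u} R} (h : IsGP X) :
    ∃ (K P : ModuleCat.{u} R) (f : K ⟶ P) (g : P ⟶ X), IsSES f g ∧ Projective P ∧ IsGP K := by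
  obtain ⟨K, P, k, p, hP, hk⟩ := exists_isSES_of_projective X
  exact ⟨K, P, k, p, hk, hP, .left hk (.of_projective P) h⟩

/-- Embeddings into projectives continue the sequence to the right, kernels of projective covers to
the left; both stay within `IsGP`. -/
lemma IsGP.exists_sequence {X : ModuleCat.{u} R} (h : IsGP X) :
    ∃ (x : ℤ → ModuleCat.{u} R) (_ : x 0 = X), ∀ i, IsGP (x i) ∧
      ∃ (P : ModuleCat.{u} R) (f : x i ⟶ P) (g : P ⟶ x (i + 1)), IsSES f g ∧ Projective P := by
  let S := { X : ModuleCat.{u} R // IsGP X }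
  let r : S → S → Prop := fun A B =>
    ∃ (P : ModuleCat.{u} R) (f : A.1 ⟶ P) (g : P ⟶ B.1), IsSES f g ∧ Projective P
  have h₁ : ∀ A : S, ∃ B : S, r A B := by
    rintro ⟨A, hA⟩
    obtain ⟨P, Y, f, g, h, hP, hY⟩ := hA.embed
    exact ⟨⟨Y, hY⟩, P, f, g, h, hP⟩
  have h₂ : ∀ B : S, ∃ A : S, r A B := by
    rintro ⟨B, hB⟩
    obtain ⟨K, P, f, g, h, hP, hK⟩ := hB.exists_prev
    exact ⟨⟨K, hK⟩, P, f, g, h, hP⟩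
  choose next hnext using h₁
  choose prev hprev using h₂
  let x : ℤ → S := fun i => match i with
    | Int.ofNat n => next^[n] ⟨X, h⟩
    | Int.negSucc n => prev^[n + 1] ⟨X, h⟩
  refine ⟨fun i => (x i).1, rfl, fun i => ⟨(x i).2, ?_⟩⟩
  change r (x i) (x (i + 1))
  match i with
  | Int.ofNat n =>
    have : x (Int.ofNat n + 1) = next (x (Int.ofNat n)) := Function.iterate_succ_apply' next n _
    rw [this]
    exact hnext _
  | Int.negSucc 0 => exact hprev _
  | Int.negSucc (n + 1) =>
    have h₁ : x (Int.negSucc (n + 1)) = prev (x (Int.negSucc n)) :=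
      Function.iterate_succ_apply' prev (n + 1) _
    rw [h₁, show Int.negSucc (n + 1) + 1 = Int.negSucc n by lia]
    exact hprev _

/-- Splice the short exact sequences. A cocycle into `Q` descends to a map on one of the `x i`,
which extends to the next projective by `Ext` vanishing. -/
lemma IsGP.isGorensteinProjective {X : ModuleCat.{u} R} (h : IsGP X) :
    IsGorensteinProjective X := by
  obtain ⟨x, rfl, hx⟩ := h.exists_sequence
  choose hx P f g hfg hP using hx
  let K : CochainComplex (ModuleCat.{u} R) ℤ := CochainComplex.of P (fun i => g i ≫ f (i + 1))
    (fun i => by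
      rw [Category.assoc, ← Category.assoc (f (i + 1)), (hfg (i + 1)).zero, zero_comp, comp_zero])
  have hd : ∀ i, K.d i (i + 1) = g i ≫ f (i + 1) := 
    fun i => CochainComplex.of_d P (fun i => g i ≫ f (i + 1)) i
  have hker : ∀ i, IsSES (f i) (g i) → ∀ y : P i, K.d i (i + 1) y = 0 → g i y = 0 := by
    intro i _ y hy
    rw [hd] at hy
    exact (hfg (i + 1)).inj (hy.trans (map_zero _).symm)
  refine ⟨K, ⟨hP, ?_, ?_⟩, ?_⟩
  · intro i
    obtain ⟨j, rfl⟩ : ∃ j, i = j + 1 := ⟨i - 1, by lia⟩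
    rw [HomologicalComplex.exactAt_iff' K j (j + 1) (j + 1 + 1) (by simp) (by simp)]
    rw [ShortComplex.moduleCat_exact_iff]
    intro y hy
    obtain ⟨z, hz⟩ := (hfg (j + 1)).lift (hker (j + 1) (hfg _) y hy)
    obtain ⟨t, rfl⟩ := (hfg j).surj z
    exact ⟨t, congr($(hd j) t).trans hz⟩
  · intro Q hQ i φ hφ
    generalize hj : i - 1 = j at hφ
    obtain rfl : i = j + 1 := by lia
    rw [hd, Category.assoc] at hφ
    have hφ' : f (j + 1) ≫ φ = 0 := by
      ext y
      obtain ⟨z, rfl⟩ := (hfg j).surj y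
      exact congr($hφ z)
    obtain ⟨ψ, hψ⟩ := (hfg (j + 1)).exists_desc φ hφ'
    obtain ⟨l, hl⟩ := (hx (j + 1 + 1 + 1)).ext.extend (hfg (j + 1 + 1)) hQ ψ
    refine ⟨l, ?_⟩
    rw [hd, Category.assoc, hl, hψ]
  · have hk : IsLimit (KernelFork.ofι (f 0) (show f 0 ≫ K.d 0 (0 + 1) = 0 by
        rw [hd, ← Category.assoc, (hfg 0).zero, zero_comp])) := by
      have : Mono (ShortComplex.mk (f 0) (K.d 0 (0 + 1)) (by
        rw [hd, ← Category.assoc, (hfg 0).zero, zero_comp])).f :=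
        (ModuleCat.mono_iff_injective _).2 (hfg 0).inj
      refine ShortComplex.Exact.fIsKernel (S := ShortComplex.mk (f 0) (K.d 0 (0 + 1)) _) ?_
      rw [ShortComplex.moduleCat_exact_iff]
      intro y hy
      exact (hfg 0).lift (hker 0 (hfg 0) y hy)
    exact ⟨(K.cyclesIsKernel 0 (0 + 1) (by simp)).conePointUniqueUpToIso hk⟩

lemma isGorensteinProjective_iff_isGP (X : ModuleCat.{u} R) :
    IsGorensteinProjective X ↔ IsGP X :=
  ⟨fun h => h.isGP, fun h => h.isGorensteinProjective⟩

end TotallyAcyclic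

/-! ### Embeddings into finitely generated projective modules. -/

section FiniteEmbedding

variable {R : Type u} [CommRing R]

lemma _root_.Submodule.FG.exists_le_supported {α : Type*} {N : Submodule R (α →₀ R)}
    (hN : N.FG) : ∃ J : Set α, J.Finite ∧ N ≤ Finsupp.supported R R J := by
  obtain ⟨S, rfl⟩ := hN
  refine ⟨⋃ x ∈ S, (x.support : Set α), ?_, ?_⟩
  · exact S.finite_toSet.biUnion fun x _ => x.support.finite_toSet
  · rw [Submodule.span_le]
    intro x hx
    change (x.support : Set α) ⊆ _
    exact Set.subset_biUnion_of_mem (u := fun x : α →₀ R => (x.support : Set α)) hx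

/-- Enlarge the projective module to a free module `F`. Being finitely generated, `X` lies in a
finite coordinate summand `E`, and `E / X` is a retract of `F / X`, hence Gorenstein projective. -/
lemma IsGP.embed_finite {X : ModuleCat.{u} R} [Module.Finite R X] (h : IsGP X) :
    ∃ (P Y : ModuleCat.{u} R) (f : X ⟶ P) (g : P ⟶ Y),
      IsSES f g ∧ Projective P ∧ Module.Finite R P ∧ Module.Finite R Y ∧ IsGP Y := by
  obtain ⟨P, Y, i, p, hi, hP, hY⟩ := h.embed
  have hP' := (IsProjective.iff_projective (R := R) P).2 hP
  obtain ⟨s, hs⟩ := Module.projective_def'.1 hP'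
  let F : ModuleCat.{u} R := ModuleCat.of R (P →₀ R)
  have hF : Projective F := (IsProjective.iff_projective (R := R) (P →₀ R)).1 inferInstance
  let s' : P ⟶ F := ModuleCat.ofHom s
  let r' : F ⟶ P := ModuleCat.ofHom (Finsupp.linearCombination R id)
  have hs' : s' ≫ r' = 𝟙 P := ModuleCat.hom_ext hs
  have hs'' := isSES_mkQ s' (fun x y hxy => by
    rw [show x = r' (s' x) from congr($hs'.symm x), hxy]
    exact congr($hs' y))
  set q := ModuleCat.ofHom (LinearMap.range s'.hom).mkQ
  -- `F` modulo the summand `P` is a retract of `F`; therefore `F / X`, an extension of `F / P` by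
  -- `P / X`, satisfies `IsGP`.
  have hq : IsGP (ModuleCat.of R (F ⧸ LinearMap.range s'.hom)) := by
    obtain ⟨l, hl⟩ := hs''.exists_desc (𝟙 F - r' ≫ s') (by
      rw [Preadditive.comp_sub, Category.comp_id, ← Category.assoc, hs', Category.id_comp,
        sub_self])
    refine .of_retract l q ?_ (.of_projective F)
    ext1
    apply LinearMap.ext
    intro x
    obtain ⟨y, rfl⟩ := hs''.surj x
    have h₁ : l (q y) = y - s' (r' y) := congr($hl y)
    change q (l (q y)) = q y
    rw [h₁, map_sub, hs''.zero_apply, sub_zero]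
  have hc := isSES_mkQ (i ≫ s') (hs''.inj.comp hi.inj)
  obtain ⟨a, b, hab, -⟩ := hi.exists_cokernels hs'' hc
  have hGP := IsGP.mid hab hY hq
  obtain ⟨J, hJ, hle⟩ := (Module.Finite.fg_top.map (i ≫ s').hom : (Submodule.map (i ≫ s').hom
    (⊤ : Submodule R X)).FG).exists_le_supported
  have := hJ.to_subtype
  let E : ModuleCat.{u} R := ModuleCat.of R (Finsupp.supported R R J)
  have e : Finsupp.supported R R J ≃ₗ[R] (J →₀ R) := Finsupp.supportedEquivFinsupp J
  have hE : Projective E :=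
    (IsProjective.iff_projective (R := R) (Finsupp.supported R R J)).1
      (Module.Projective.of_equiv e.symm)
  have hE' : Module.Finite R E := Module.Finite.equiv e.symm
  let k : X ⟶ E := ModuleCat.ofHom ((i ≫ s').hom.codRestrict _
    (fun x => hle (Submodule.mem_map_of_mem trivial)))
  let ι : E ⟶ F := ModuleCat.ofHom (Finsupp.supported R R J).subtype
  classical
  let ρ : F ⟶ E := ModuleCat.ofHom (Finsupp.restrictDom R R J)
  have hιρ : ι ≫ ρ = 𝟙 E := ModuleCat.hom_ext (Finsupp.restrictDom_comp_subtype J)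
  have hkι : k ≫ ι = i ≫ s' := rfl
  have hk := isSES_mkQ k (fun x y hxy => hc.inj (congr_arg ι hxy))
  obtain ⟨u, hu⟩ := hk.exists_desc (ι ≫ ModuleCat.ofHom (LinearMap.range (i ≫ s').hom).mkQ) (by
    rw [← Category.assoc, hkι, hc.zero])
  obtain ⟨v, hv⟩ := hc.exists_desc (ρ ≫ ModuleCat.ofHom (LinearMap.range k.hom).mkQ) (by
    rw [← hkι, Category.assoc, ← Category.assoc ι, hιρ, Category.id_comp, hk.zero])
  refine ⟨E, _, k, _, hk, hE, hE', ?_, .of_retract u v ?_ hGP⟩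
  · exact Module.Finite.of_surjective _ (Submodule.mkQ_surjective (LinearMap.range k.hom))
  · have : Epi (ModuleCat.ofHom (LinearMap.range k.hom).mkQ) :=
      (ModuleCat.epi_iff_surjective _).2 hk.surj
    rw [← cancel_epi (ModuleCat.ofHom (LinearMap.range k.hom).mkQ), ← Category.assoc, hu,
      Category.assoc, hv, ← Category.assoc, hιρ, Category.id_comp]
    exact (Category.comp_id _).symm

end FiniteEmbedding

/-! ### Finite Gorenstein dimension, syzygies and approximations. -/

section Gdim

variable {R : Type u} [CommRing R]

lemma fgGorensteinProjective_iff (X : ModuleCat.{u} R) :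
    fgGorensteinProjective R X ↔ Module.Finite R X ∧ IsGP X := by
  rw [← isGorensteinProjective_iff_isGP]
  rfl

lemma fgGorensteinProjective.finite {X : ModuleCat.{u} R} (h : fgGorensteinProjective R X) :
    Module.Finite R X := h.1

lemma fgGorensteinProjective.isGP {X : ModuleCat.{u} R} (h : fgGorensteinProjective R X) :
    IsGP X := h.2.isGP

lemma fgGorensteinProjective.of_iso {X Y : ModuleCat.{u} R} (e : X ≅ Y)
    (h : fgGorensteinProjective R X) : fgGorensteinProjective R Y := by
  have := h.finite
  exact (fgGorensteinProjective_iff Y).2 ⟨Module.Finite.equiv e.toLinearEquiv, h.isGP.of_iso e⟩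

lemma fgGorensteinProjective_of_projective (P : ModuleCat.{u} R) [Projective P]
    [h : Module.Finite R P] : fgGorensteinProjective R P :=
  (fgGorensteinProjective_iff P).2 ⟨h, .of_projective P⟩

lemma fgGorensteinProjective_punit :
    fgGorensteinProjective R (ModuleCat.of R PUnit.{u + 1}) := by
  have : Projective (ModuleCat.of R PUnit.{u + 1}) :=
    (IsProjective.iff_projective (R := R) PUnit.{u + 1}).1 inferInstance
  have : Module.Finite R (ModuleCat.of R PUnit.{u + 1}) :=
    inferInstanceAs (Module.Finite R PUnit.{u + 1})
  exact fgGorensteinProjective_of_projective _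

namespace IsSES

variable {A B D : ModuleCat.{u} R} {f : A ⟶ B} {g : B ⟶ D}

lemma finite_right (h : IsSES f g) [Module.Finite R B] : Module.Finite R D :=
  Module.Finite.of_surjective g.hom h.surj

lemma finite_left [IsNoetherianRing R] (h : IsSES f g) [Module.Finite R B] : Module.Finite R A :=
  Module.Finite.of_injective f.hom h.inj

lemma finite_mid (h : IsSES f g) [Module.Finite R A] [Module.Finite R D] : Module.Finite R B :=
  Module.Finite.of_exact (f := f.hom) (g := g.hom) h.exact h.surj

end IsSES

lemma fgGorensteinProjective.mid {A B D : ModuleCat.{u} R} {f : A ⟶ B} {g : B ⟶ D}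
    (h : IsSES f g) (hA : fgGorensteinProjective R A) (hD : fgGorensteinProjective R D) :
    fgGorensteinProjective R B := by
  have := hA.finite
  have := hD.finite
  exact (fgGorensteinProjective_iff B).2 ⟨h.finite_mid, .mid h hA.isGP hD.isGP⟩

lemma fgGorensteinProjective.prod {A B : ModuleCat.{u} R} (hA : fgGorensteinProjective R A)
    (hB : fgGorensteinProjective R B) : fgGorensteinProjective R (ModuleCat.of R (A × B)) :=
  .mid (isSES_prod A B) hA hB

lemma fgGorensteinProjective.of_prod {A B : ModuleCat.{u} R}
    (h : fgGorensteinProjective R (ModuleCat.of R (A × B))) : fgGorensteinProjective R A := by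
  have : Module.Finite R (A × B) := h.finite
  exact (fgGorensteinProjective_iff A).2
    ⟨Module.Finite.of_surjective (LinearMap.fst R A B) LinearMap.fst_surjective, h.isGP.of_prod⟩

lemma HasGdimLE.succ {n : ℕ} {L G N : ModuleCat.{u} R} {f : L ⟶ G} {g : G ⟶ N} (h : IsSES f g)
    (hG : fgGorensteinProjective R G) (hL : HasGdimLE n L) : HasGdimLE (n + 1) N :=
  ⟨h.sc, h.shortExact, ⟨Iso.refl N⟩, hG, hL⟩

lemma HasGdimLE.exists_isSES {n : ℕ} {N : ModuleCat.{u} R} (h : HasGdimLE (n + 1) N) :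
    ∃ (L G : ModuleCat.{u} R) (f : L ⟶ G) (g : G ⟶ N),
      IsSES f g ∧ fgGorensteinProjective R G ∧ HasGdimLE n L := by
  obtain ⟨S, hS, ⟨e⟩, hG, hL⟩ := h
  exact ⟨S.X₁, S.X₂, _, _, hS.isSES.iso_comp (Iso.refl _) e, hG, hL⟩

lemma HasGdimLE.of_iso {n : ℕ} {X Y : ModuleCat.{u} R} (e : X ≅ Y) (h : HasGdimLE n X) :
    HasGdimLE n Y := by
  cases n with
  | zero => exact fgGorensteinProjective.of_iso e h
  | succ n =>
    obtain ⟨L, G, f, g, h, hG, hL⟩ := h.exists_isSES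
    exact .succ (h.iso_comp (Iso.refl _) e) hG hL

lemma HasGdimLE.finite {n : ℕ} {N : ModuleCat.{u} R} (h : HasGdimLE n N) : Module.Finite R N := by
  cases n with
  | zero => exact fgGorensteinProjective.finite h
  | succ n =>
    obtain ⟨L, G, f, g, h, hG, hL⟩ := h.exists_isSES
    have := hG.finite
    exact h.finite_right

lemma isSES_from_punit (A : ModuleCat.{u} R) :
    IsSES (0 : ModuleCat.of R PUnit.{u + 1} ⟶ A) (𝟙 A) where
  inj := fun _ _ _ => rfl
  surj := Function.surjective_id
  exact := by
    intro x
    constructor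
    · rintro (rfl : x = 0)
      exact ⟨0, rfl⟩
    · rintro ⟨y, rfl⟩
      rfl

lemma HasGdimLE.step {n : ℕ} {N : ModuleCat.{u} R} (h : HasGdimLE n N) : HasGdimLE (n + 1) N := by
  induction n generalizing N with
  | zero => exact .succ (isSES_from_punit N) h (n := 0) fgGorensteinProjective_punit
  | succ n ih =>
    obtain ⟨L, G, f, g, h, hG, hL⟩ := h.exists_isSES
    exact .succ h hG (ih hL)

lemma HasGdimLE.mono {n m : ℕ} (hnm : n ≤ m) {N : ModuleCat.{u} R} (h : HasGdimLE n N) :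
    HasGdimLE m N := by
  induction hnm with
  | refl => exact h
  | step _ ih => exact ih.step

lemma HasGdimLE.prod {n : ℕ} {A B : ModuleCat.{u} R} (hA : HasGdimLE n A) (hB : HasGdimLE n B) :
    HasGdimLE n (ModuleCat.of R (A × B)) := by
  induction n generalizing A B with
  | zero => exact fgGorensteinProjective.prod hA hB
  | succ n ih =>
    obtain ⟨L, G, f, g, h, hG, hL⟩ := hA.exists_isSES
    obtain ⟨L', G', f', g', h', hG', hL'⟩ := hB.exists_isSES
    exact .succ (h.prod h') (hG.prod hG') (ih hL hL')

section Noetherian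

variable [IsNoetherianRing R]

lemma fgGorensteinProjective.left {A B D : ModuleCat.{u} R} {f : A ⟶ B} {g : B ⟶ D}
    (h : IsSES f g) (hB : fgGorensteinProjective R B) (hD : fgGorensteinProjective R D) :
    fgGorensteinProjective R A := by
  have := hB.finite
  exact (fgGorensteinProjective_iff A).2 ⟨h.finite_left, .left h hB.isGP hD.isGP⟩

/-- If `G'` maps onto `Y` with kernel `L`, the kernel of `G' ⟶ G` is Gorenstein projective and maps
onto `K` with the same kernel `L`. -/
lemma HasGdimLE.left {n : ℕ} {K Y G : ModuleCat.{u} R} {f : K ⟶ Y} {g : Y ⟶ G} (h : IsSES f g)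
    (hY : HasGdimLE n Y) (hG : fgGorensteinProjective R G) : HasGdimLE n K := by
  cases n with
  | zero => exact fgGorensteinProjective.left h hY hG
  | succ n =>
    obtain ⟨L, G', f', g', h', hG', hL⟩ := hY.exists_isSES
    have hk := isSES_ker (g' ≫ g) (h.surj.comp h'.surj)
    obtain ⟨a, b, hab⟩ := h'.exists_kernels h hk
    exact .succ hab (.left hk hG' hG) hL

/-- Pulled back along a projective cover `P` of `Z`, the extension splits as `L × P`. A Gorenstein
projective cover of this product also covers `X`, with kernel an extension of the syzygy of `Z` by a
module of dimension at most `n`. -/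
lemma HasGdimLE.mid {n : ℕ} {L X Z : ModuleCat.{u} R} {f : L ⟶ X} {g : X ⟶ Z} (h : IsSES f g)
    (hL : HasGdimLE n L) (hZ : fgGorensteinProjective R Z) : HasGdimLE n X := by
  induction n generalizing L X Z with
  | zero => exact fgGorensteinProjective.mid h hL hZ
  | succ n ih =>
    have := hZ.finite
    obtain ⟨Z', P, k, p, hP, hP', -, hk⟩ := exists_isSES_of_finite Z
    have hPG := fgGorensteinProjective_of_projective P
    have hZ' := fgGorensteinProjective.left hk hPG hZ
    obtain ⟨W, f', g', k', q', h₁, h₂⟩ := h.exists_pullback hk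
    have : Epi g' := (ModuleCat.epi_iff_surjective _).2 h₁.surj
    obtain ⟨e⟩ := h₁.iso_prod (Projective.factorThru (𝟙 P) g') (Projective.factorThru_comp _ _)
    have hP₀ : HasGdimLE 0 P := hPG
    have hW : HasGdimLE (n + 1) W := (hL.prod (hP₀.mono (Nat.zero_le _))).of_iso e.symm
    obtain ⟨L', G, u, v, h₃, hG, hL'⟩ := hW.exists_isSES
    have h₄ := isSES_ker (v ≫ q') (h₂.surj.comp h₃.surj)
    obtain ⟨a, b, hab⟩ := h₃.exists_kernels h₂ h₄
    exact .succ h₄ hG (ih hab hL' hZ')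

/-- A Schanuel argument makes the syzygy independent of the cover: the pullback `X` is an extension
of `Z` by `L` and also of `G` by `B`. -/
lemma HasGdimLE.syzygy {n : ℕ} {B Z H : ModuleCat.{u} R} {f : B ⟶ Z} {g : Z ⟶ H}
    (h : IsSES f g) (hZ : fgGorensteinProjective R Z) (hH : HasGdimLE (n + 1) H) :
    HasGdimLE n B := by
  obtain ⟨L, G, u, v, h', hG, hL⟩ := hH.exists_isSES
  obtain ⟨X, f', g', k', q', h₁, h₂⟩ := h.exists_pullback h'
  exact .left h₁ (.mid h₂ hL hZ) hG

/-- Syzygies of `A × B` can be taken componentwise, which reduces to summands of Gorenstein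
projectives. -/
lemma HasGdimLE.of_prod {n : ℕ} {A B : ModuleCat.{u} R}
    (h : HasGdimLE n (ModuleCat.of R (A × B))) : HasGdimLE n A := by
  induction n generalizing A B with
  | zero => exact fgGorensteinProjective.of_prod h
  | succ n ih =>
    have : Module.Finite R (A × B) := h.finite
    have : Module.Finite R A :=
      Module.Finite.of_surjective (LinearMap.fst R A B) LinearMap.fst_surjective
    have : Module.Finite R B :=
      Module.Finite.of_surjective (LinearMap.snd R A B) LinearMap.snd_surjective
    obtain ⟨K, P, k, p, hP, hP', -, hk⟩ := exists_isSES_of_finite A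
    obtain ⟨K', P', k', p', hQ, hQ', -, hk'⟩ := exists_isSES_of_finite B
    have hPG := fgGorensteinProjective_of_projective P
    have hQG := fgGorensteinProjective_of_projective P'
    exact .succ hk hPG (ih (.syzygy (hk.prod hk') (hPG.prod hQG) h))

lemma HasGdimLE.of_retract {n : ℕ} {X Y : ModuleCat.{u} R} (i : X ⟶ Y) (r : Y ⟶ X)
    (hir : i ≫ r = 𝟙 X) (hY : HasGdimLE n Y) : HasGdimLE n X := by
  have h := isSES_ker r (fun x => ⟨i x, congr($hir x)⟩)
  obtain ⟨e⟩ := h.iso_prod i hir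
  exact of_prod (hY.of_iso (e ≪≫ (LinearEquiv.prodComm R _ _).toModuleIso))

end Noetherian

/-- Finitely generated modules with a resolution of length `n` by finitely generated projective
modules. -/
def HasPdLE : ℕ → ModuleCat.{u} R → Prop
  | 0, N => Projective N ∧ Module.Finite R N
  | n + 1, N => ∃ (K P : ModuleCat.{u} R) (f : K ⟶ P) (g : P ⟶ N),
      IsSES f g ∧ (Projective P ∧ Module.Finite R P) ∧ HasPdLE n K

lemma HasPdLE.hasGdimLE {n : ℕ} {N : ModuleCat.{u} R} (h : HasPdLE n N) : HasGdimLE n N := by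
  induction n generalizing N with
  | zero =>
    obtain ⟨h, h'⟩ := h
    exact fgGorensteinProjective_of_projective N
  | succ n ih =>
    obtain ⟨K, P, f, g, h, ⟨hP, hP'⟩, hK⟩ := h
    exact .succ h (fgGorensteinProjective_of_projective P) (ih hK)

/-- A module of Gorenstein dimension at most `n` embeds into a module of projective dimension at
most `n` with Gorenstein projective cokernel. -/
lemma HasGdimLE.exists_hull {n : ℕ} {N : ModuleCat.{u} R} (hN : HasGdimLE n N) :
    ∃ (H G : ModuleCat.{u} R) (f : N ⟶ H) (g : H ⟶ G),
      IsSES f g ∧ HasPdLE n H ∧ fgGorensteinProjective R G := by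
  induction n generalizing N with
  | zero =>
    have := hN.finite
    obtain ⟨P, Y, f, g, h, hP, hP', hY, hY'⟩ := (fgGorensteinProjective.isGP hN).embed_finite
    exact ⟨P, Y, f, g, h, ⟨hP, hP'⟩, (fgGorensteinProjective_iff Y).2 ⟨hY, hY'⟩⟩
  | succ n ih =>
    obtain ⟨L, G, f, g, h, hG, hL⟩ := hN.exists_isSES
    obtain ⟨H, G', f', g', h', hH, hG'⟩ := ih hL
    -- `W` is an extension of `G'` by `G`, and `W / H = N`. For an embedding of `W` into a
    -- projective `P`, the module `P / H` has projective dimension at most `n + 1` and contains `N`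
    -- with cokernel `P / W`.
    obtain ⟨W, a, b, c, d, h₁, h₂, -⟩ := h.exists_pushout h'
    have hW := fgGorensteinProjective.mid h₂ hG hG'
    have := hW.finite
    obtain ⟨P, Y, i, p, h₃, hP, hP', hY, hY'⟩ := hW.isGP.embed_finite
    have h₄ := isSES_mkQ (a ≫ i) (h₃.inj.comp h₁.inj)
    obtain ⟨s, t, hst, -⟩ := h₁.exists_cokernels h₃ h₄
    exact ⟨_, Y, s, t, hst, ⟨H, P, _, _, h₄, ⟨hP, hP'⟩, hH⟩,
      (fgGorensteinProjective_iff Y).2 ⟨hY, hY'⟩⟩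

/-- A module of Gorenstein dimension at most `n + 1` is a quotient of a Gorenstein projective
module by a module of projective dimension at most `n`. -/
lemma HasGdimLE.exists_approximation {n : ℕ} {N : ModuleCat.{u} R} (hN : HasGdimLE (n + 1) N) :
    ∃ (K G : ModuleCat.{u} R) (f : K ⟶ G) (g : G ⟶ N),
      IsSES f g ∧ HasPdLE n K ∧ fgGorensteinProjective R G := by
  obtain ⟨L, G, f, g, h, hG, hL⟩ := hN.exists_isSES
  obtain ⟨H, G', f', g', h', hH, hG'⟩ := hL.exists_hull
  -- Replacing the kernel `L` by its hull `H` enlarges `G` to `W`, an extension of `G'` by `G`.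
  obtain ⟨W, a, b, c, d, h₁, h₂, -⟩ := h.exists_pushout h'
  exact ⟨H, W, a, b, h₁, hH, .mid h₂ hG hG'⟩

end Gdim

/-! ### Distinguished triangles, octahedra and the iterated envelope. -/

section Triangles

open Pretriangulated Triangulated

variable {C : Type*} [Category* C] [HasZeroObject C] [HasShift C ℤ] [Preadditive C]
  [∀ n : ℤ, (shiftFunctor C n).Additive] [Pretriangulated C]

/-- `X ⟶ Y ⟶ Z ⟶ X⟦1⟧` is a distinguished triangle. -/
def IsTri {X Y Z : C} (f : X ⟶ Y) (g : Y ⟶ Z) (h : Z ⟶ X⟦(1 : ℤ)⟧) : Prop :=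
  Triangle.mk f g h ∈ distTriang C

namespace IsTri

variable {X Y Z : C} {f : X ⟶ Y} {g : Y ⟶ Z} {h : Z ⟶ X⟦(1 : ℤ)⟧}

lemma zero₁₂ (H : IsTri f g h) : f ≫ g = 0 := comp_distTriang_mor_zero₁₂ _ H

lemma zero₃₁ (H : IsTri f g h) : h ≫ f⟦(1 : ℤ)⟧' = 0 := comp_distTriang_mor_zero₃₁ _ H

lemma rotate (H : IsTri f g h) : IsTri g h (-f⟦(1 : ℤ)⟧') := rot_of_distTriang _ H

lemma desc (H : IsTri f g h) {W : C} (u : Y ⟶ W) (hu : f ≫ u = 0) : ∃ v : Z ⟶ W, g ≫ v = u := by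
  obtain ⟨v, hv⟩ := Triangle.yoneda_exact₂ _ H u hu
  exact ⟨v, hv.symm⟩

lemma lift (H : IsTri f g h) {W : C} (u : W ⟶ Y) (hu : u ≫ g = 0) : ∃ v : W ⟶ X, v ≫ f = u := by
  obtain ⟨v, hv⟩ := Triangle.coyoneda_exact₂ _ H u hu
  exact ⟨v, hv.symm⟩

lemma desc₃ (H : IsTri f g h) {W : C} (u : Z ⟶ W) (hu : g ≫ u = 0) :
    ∃ v : X⟦(1 : ℤ)⟧ ⟶ W, h ≫ v = u := H.rotate.desc u hu

lemma lift₃ (H : IsTri f g h) {W : C} (u : W ⟶ Z) (hu : u ≫ h = 0) :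
    ∃ v : W ⟶ Y, v ≫ g = u := H.rotate.lift u hu

lemma lift₁ (H : IsTri f g h) {W : C} (u : W ⟶ X⟦(1 : ℤ)⟧) (hu : u ≫ f⟦(1 : ℤ)⟧' = 0) :
    ∃ v : W ⟶ Z, v ≫ h = u := H.rotate.rotate.lift u (by simp [hu])

lemma of_iso (H : IsTri f g h) {X' Y' Z' : C} {f' : X' ⟶ Y'} {g' : Y' ⟶ Z'}
    {h' : Z' ⟶ X'⟦(1 : ℤ)⟧} (a : X ≅ X') (b : Y ≅ Y') (c : Z ≅ Z')
    (h₁ : f ≫ b.hom = a.hom ≫ f') (h₂ : g ≫ c.hom = b.hom ≫ g')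
    (h₃ : h ≫ a.hom⟦(1 : ℤ)⟧' = c.hom ≫ h') : IsTri f' g' h' :=
  isomorphic_distinguished _ H _ (Triangle.isoMk (Triangle.mk f g h) (Triangle.mk f' g' h')
    a b c h₁ h₂ h₃).symm

lemma of_iso₁ (H : IsTri f g h) {X' : C} (a : X ≅ X') :
    IsTri (a.inv ≫ f) g (h ≫ a.hom⟦(1 : ℤ)⟧') :=
  H.of_iso a (Iso.refl _) (Iso.refl _) (by simp) (by simp) (by simp)

lemma of_iso₂ (H : IsTri f g h) {Y' : C} (b : Y ≅ Y') :
    IsTri (f ≫ b.hom) (b.inv ≫ g) h :=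
  H.of_iso (Iso.refl _) b (Iso.refl _) (by simp) (by simp) (by simp)

lemma of_iso₃ (H : IsTri f g h) {Z' : C} (c : Z ≅ Z') :
    IsTri f (g ≫ c.hom) (c.inv ≫ h) :=
  H.of_iso (Iso.refl _) (Iso.refl _) c (by simp) (by simp) (by simp)

lemma shift (H : IsTri f g h) : IsTri (f⟦(1 : ℤ)⟧') (g⟦(1 : ℤ)⟧') (-h⟦(1 : ℤ)⟧') := by
  -- Three rotations negate all three maps; `-𝟙` on the middle object removes two of the signs.
  refine IsTri.of_iso H.rotate.rotate.rotate (Iso.refl _) (-Iso.refl _) (Iso.refl _) ?_ ?_ ?_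
  · simp
  · simp
  · simp

lemma exists_unrotate {k : X⟦(1 : ℤ)⟧ ⟶ Y⟦(1 : ℤ)⟧} (H : IsTri g h k) :
    ∃ f : X ⟶ Y, f⟦(1 : ℤ)⟧' = -k ∧ IsTri f g h := by
  obtain ⟨f, hf⟩ := (shiftFunctor C (1 : ℤ)).map_surjective (-k)
  refine ⟨f, hf, (rotate_distinguished_triangle _).2 ?_⟩
  have : Triangle.mk g h (-f⟦(1 : ℤ)⟧') ∈ distTriang C := by
    rw [hf, neg_neg]
    exact H
  exact this

lemma exists_shift (H : IsTri f g h) (n : ℤ) :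
    ∃ (f' : X⟦n⟧ ⟶ Y⟦n⟧) (g' : Y⟦n⟧ ⟶ Z⟦n⟧) (h' : _), IsTri f' g' h' :=
  ⟨_, _, _, Triangle.shift_distinguished _ H n⟩

lemma shift_lift₃ (H : IsTri f g h) {W : C} {n : ℤ} (u : W ⟶ Z⟦n⟧) (hu : u ≫ h⟦n⟧' = 0) :
    ∃ v : W ⟶ Y⟦n⟧, v ≫ g⟦n⟧' = u := by
  let e : (W⟦-n⟧)⟦n⟧ ≅ W := shiftNegShift W n
  obtain ⟨u', hu'⟩ := (shiftFunctor C n).map_surjective (e.hom ≫ u)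
  obtain ⟨v, hv⟩ := H.lift₃ u' ((shiftFunctor C n).map_injective (by
    rw [Functor.map_comp, hu', Category.assoc, hu]
    simp))
  refine ⟨e.inv ≫ v⟦n⟧', ?_⟩
  rw [Category.assoc, ← Functor.map_comp, hv, hu', Iso.inv_hom_id_assoc]

lemma split (H : IsTri f g h) (h0 : h = 0) :
    ∃ e : Y ≅ X ⊞ Z, f ≫ e.hom = biprod.inl ∧ g = e.hom ≫ biprod.snd :=
  exists_iso_binaryBiproduct_of_distTriang _ H h0

lemma exists_cone (f : X ⟶ Y) : ∃ (Z : C) (g : Y ⟶ Z) (h : Z ⟶ X⟦(1 : ℤ)⟧), IsTri f g h :=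
  distinguished_cocone_triangle f

lemma exists_fiber (g : Y ⟶ Z) : ∃ (X : C) (f : X ⟶ Y) (h : Z ⟶ X⟦(1 : ℤ)⟧), IsTri f g h :=
  distinguished_cocone_triangle₁ g

lemma exists_middle (h : Z ⟶ X⟦(1 : ℤ)⟧) : ∃ (Y : C) (f : X ⟶ Y) (g : Y ⟶ Z), IsTri f g h :=
  distinguished_cocone_triangle₂ h

lemma biprod (X Y : C) : IsTri (biprod.inl : X ⟶ X ⊞ Y) biprod.snd 0 :=
  binaryBiproductTriangle_distinguished X Y

lemma exists_octahedron [IsTriangulated C] {X₁ X₂ X₃ Z₁₂ Z₂₃ Z₁₃ : C} {a : X₁ ⟶ X₂} {b : X₂ ⟶ X₃}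
    {v₁₂ : X₂ ⟶ Z₁₂} {w₁₂ : Z₁₂ ⟶ X₁⟦(1 : ℤ)⟧} (h₁₂ : IsTri a v₁₂ w₁₂)
    {v₂₃ : X₃ ⟶ Z₂₃} {w₂₃ : Z₂₃ ⟶ X₂⟦(1 : ℤ)⟧} (h₂₃ : IsTri b v₂₃ w₂₃)
    {v₁₃ : X₃ ⟶ Z₁₃} {w₁₃ : Z₁₃ ⟶ X₁⟦(1 : ℤ)⟧} (h₁₃ : IsTri (a ≫ b) v₁₃ w₁₃) :
    ∃ (m₁ : Z₁₂ ⟶ Z₁₃) (m₃ : Z₁₃ ⟶ Z₂₃), v₁₂ ≫ m₁ = b ≫ v₁₃ ∧ m₁ ≫ w₁₃ = w₁₂ ∧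
      v₁₃ ≫ m₃ = v₂₃ ∧ w₁₃ ≫ a⟦(1 : ℤ)⟧' = m₃ ≫ w₂₃ ∧
      IsTri m₁ m₃ (w₂₃ ≫ v₁₂⟦(1 : ℤ)⟧') :=
  have o := someOctahedron rfl h₁₂ h₂₃ h₁₃
  ⟨o.m₁, o.m₃, o.comm₁, o.comm₂, o.comm₃, o.comm₄, o.mem⟩

lemma exists_octahedron' [IsTriangulated C] {X₁ X₂ X₃ Z₁₂ Z₂₃ Z₁₃ : C} {a : X₁ ⟶ X₂} {b : X₂ ⟶ X₃}
    {v₁₂ : Z₁₂ ⟶ X₁} {w₁₂ : X₂ ⟶ Z₁₂⟦(1 : ℤ)⟧} (h₁₂ : IsTri v₁₂ a w₁₂)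
    {v₂₃ : Z₂₃ ⟶ X₂} {w₂₃ : X₃ ⟶ Z₂₃⟦(1 : ℤ)⟧} (h₂₃ : IsTri v₂₃ b w₂₃)
    {v₁₃ : Z₁₃ ⟶ X₁} {w₁₃ : X₃ ⟶ Z₁₃⟦(1 : ℤ)⟧} (h₁₃ : IsTri v₁₃ (a ≫ b) w₁₃) :
    ∃ (m₁ : Z₁₂ ⟶ Z₁₃) (m₃ : Z₁₃ ⟶ Z₂₃), m₁ ≫ v₁₃ = v₁₂ ∧ w₁₂ ≫ m₁⟦(1 : ℤ)⟧' = b ≫ w₁₃ ∧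
      w₁₃ ≫ m₃⟦(1 : ℤ)⟧' = w₂₃ ∧ m₃ ≫ v₂₃ = v₁₃ ≫ a ∧ IsTri m₁ m₃ (v₂₃ ≫ w₁₂) :=
  have o := someOctahedron' rfl h₁₂ h₂₃ h₁₃
  ⟨o.m₁, o.m₃, o.comm₁, o.comm₂, o.comm₃, o.comm₄, o.mem⟩

end IsTri

section Iter

variable {P Q : ObjectProperty C}

lemma triangEnvelopeIter_zero_le [Q.IsStableUnderRetracts]
    (hQ : ∀ X (n : ℤ), P X → Q (X⟦n⟧)) (hQ' : ∀ X Y, Q X → Q Y → Q (X ⊞ Y)) :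
    P.triangEnvelopeIter 0 ≤ Q := by
  have : Q.IsClosedUnderBinaryProducts := by
    refine ObjectProperty.IsClosedUnderLimitsOfShape.mk' ?_
    rintro X ⟨F, hF⟩
    refine Q.prop_of_iso ?_ (hQ' _ _ (hF ⟨.left⟩) (hF ⟨.right⟩))
    exact (biprod.isoProd _ _) ≪≫ (HasLimit.isoOfNatIso (diagramIsoPair F).symm)
  rw [ObjectProperty.triangEnvelopeIter_zero, ObjectProperty.retractClosure_le_iff]
  refine ObjectProperty.limitsClosure_le ?_
  rintro X ⟨Y, n, e, hX⟩
  exact Q.prop_of_iso e.symm (hQ _ _ hX)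

lemma triangEnvelopeIter_zero_biprod {X Y : C} (hX : P.triangEnvelopeIter 0 X)
    (hY : P.triangEnvelopeIter 0 Y) : P.triangEnvelopeIter 0 (X ⊞ Y) := by
  rw [ObjectProperty.triangEnvelopeIter_zero] at *
  obtain ⟨X', hX', ⟨r⟩⟩ := hX
  obtain ⟨Y', hY', ⟨r'⟩⟩ := hY
  have h : (P.shiftClosure ℤ).binaryProductsClosure (X' ⨯ Y') :=
    ObjectProperty.prop_prod _ _ _ hX' hY'
  refine ⟨X' ⨯ Y', h, ⟨⟨biprod.map r.i r'.i ≫ (biprod.isoProd _ _).hom,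
    (biprod.isoProd _ _).inv ≫ biprod.map r.r r'.r, ?_⟩⟩⟩
  rw [Category.assoc, Iso.hom_inv_id_assoc]
  ext <;> simp

lemma triangEnvelopeIter_of_isZero {n : ℕ} {X Z : C} (hX : P X) (hZ : IsZero Z) :
    P.triangEnvelopeIter n Z :=
  ObjectProperty.IsStableUnderRetracts.of_retract ⟨0, 0, hZ.eq_of_src _ _⟩
    (P.le_triangEnvelopeIter n _ hX)

lemma IsTri.triangEnvelopeIter_succ {K M N : C} {f : K ⟶ M} {g : M ⟶ N} {h : N ⟶ K⟦(1 : ℤ)⟧}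
    (H : IsTri f g h) {n : ℕ} (hK : P.triangEnvelopeIter 0 K) (hN : P.triangEnvelopeIter n N) :
    P.triangEnvelopeIter (n + 1) M := by
  rw [ObjectProperty.triangEnvelopeIter_succ, ← ObjectProperty.triangEnvelopeIter_zero]
  exact ObjectProperty.le_retractClosure _ _ ⟨_, _, _, _, _, H, hK, hN⟩

lemma triangEnvelopeIter_shift {n : ℕ} {M : C} (h : P.triangEnvelopeIter n M) (k : ℤ) :
    P.triangEnvelopeIter n (M⟦k⟧) :=
  ObjectProperty.le_shift _ k _ h

end Iter

end Triangles

/-! ### Modules inside the derived category and vanishing of morphisms. -/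

section Derived

open DerivedCategory Abelian

variable {R : Type u} [CommRing R] [HasDerivedCategory.{w} (ModuleCat.{u} R)]

/-- The map of complexes concentrated in degree `0` induced by a map of modules. -/
noncomputable abbrev singleMap {A B : ModuleCat.{u} R} (f : A ⟶ B) : single A ⟶ single B :=
  (singleFunctor (ModuleCat.{u} R) 0).map f

instance isLE_shift_one (X : DerivedCategory (ModuleCat.{u} R)) [X.IsLE 0] :
    (X⟦(1 : ℤ)⟧).IsLE (-1) := TStructure.t.isLE_shift X 0 1 (-1) (by lia)

lemma isLE_zero_of_neg_one (X : DerivedCategory (ModuleCat.{u} R)) [X.IsLE (-1)] : X.IsLE 0 :=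
  TStructure.t.isLE_of_le X (-1) 0

section

variable {X Y Z : DerivedCategory (ModuleCat.{u} R)} {f : X ⟶ Y} {g : Y ⟶ Z} {h : Z ⟶ X⟦(1 : ℤ)⟧}

lemma IsTri.isLE (H : IsTri f g h) (n : ℤ) [X.IsLE n] [Z.IsLE n] : Y.IsLE n :=
  TStructure.t.isLE₂ _ H n ‹_› ‹_›

lemma IsTri.isGE (H : IsTri f g h) (n : ℤ) [X.IsGE n] [Z.IsGE n] : Y.IsGE n :=
  TStructure.t.isGE₂ _ H n ‹_› ‹_›

lemma IsTri.isLE₃ (H : IsTri f g h) (n : ℤ) [Y.IsLE n] [X.IsLE (n + 1)] : Z.IsLE n :=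
  have := TStructure.t.isLE_shift X (n + 1) 1 n
  TStructure.t.isLE₂ _ H.rotate n ‹_› ‹_›

end

lemma hom_eq_zero_of_projective {P : ModuleCat.{u} R} [Projective P]
    {X : DerivedCategory (ModuleCat.{u} R)} [X.IsLE (-1)] (f : single P ⟶ X) : f = 0 := by
  obtain ⟨K, _, ⟨e⟩⟩ := X.exists_iso_Q_obj_of_isLE (-1)
  let e' := (singleFunctorIsoCompQ (ModuleCat.{u} R) 0).app P
  have h : e'.inv ≫ f ≫ e.hom = 0 :=
    from_singleFunctor_obj_eq_zero_of_projective _ (-1) (by lia)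
  rw [← cancel_epi e'.inv, ← cancel_mono e.hom, Category.assoc, h]
  simp

lemma hom_eq_zero_of_isLE {B : ModuleCat.{u} R} {X : DerivedCategory (ModuleCat.{u} R)}
    [X.IsLE (-1)] (f : X ⟶ single B) : f = 0 := TStructure.t.zero f (-1) 0

lemma IsSES.exists_isTri {A B D : ModuleCat.{u} R} {f : A ⟶ B} {g : B ⟶ D} (h : IsSES f g) :
    ∃ δ, IsTri (singleMap f) (singleMap g) δ :=
  ⟨_, h.shortExact.singleTriangle_distinguished⟩

/-- Elements are tested by maps from `R`. Injectivity holds as `(single R)⟦1⟧` has no maps to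
`single D`, surjectivity as `single R` has none to `(single A)⟦1⟧`. -/
lemma isSES_of_isTri {A B D : ModuleCat.{u} R} {f : A ⟶ B} {g : B ⟶ D}
    {δ : single D ⟶ (single A)⟦(1 : ℤ)⟧} (h : IsTri (singleMap f) (singleMap g) δ) :
    IsSES f g := by
  let S := singleFunctor (ModuleCat.{u} R) 0
  let t {N : ModuleCat.{u} R} (x : N) : ModuleCat.of R R ⟶ N :=
    ModuleCat.ofHom (LinearMap.toSpanSingleton R N x)
  have ht {N : ModuleCat.{u} R} (x : N) : t x (1 : R) = x := by simp [t]
  have ht' {N N' : ModuleCat.{u} R} (x : N) (v : N ⟶ N') : t x ≫ v = t (v x) := by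
    ext
    simp [t]
  have ht0 (N : ModuleCat.{u} R) : t (0 : N) = 0 := by
    ext
    simp [t]
  have : Projective (ModuleCat.of R R) :=
    ModuleCat.projective_of_categoryTheory_projective _
  have hfg : f ≫ g = 0 := S.map_injective (by simpa using h.zero₁₂)
  refine ⟨?_, ?_, ?_⟩
  · rw [injective_iff_map_eq_zero]
    intro x hx
    have h0 : t x = 0 := by
      apply S.map_injective
      apply (shiftFunctor _ (1 : ℤ)).map_injective
      obtain ⟨v, hv⟩ := h.lift₁ ((singleMap (t x))⟦(1 : ℤ)⟧') (by
        rw [← Functor.map_comp, ← Functor.map_comp, ht', hx, ht0]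
        simp)
      change (singleMap (t x))⟦(1 : ℤ)⟧' = _
      rw [← hv, hom_eq_zero_of_isLE v]
      simp
    rw [← ht x, h0]
    rfl
  · intro x
    obtain ⟨v, hv⟩ := h.lift₃ (singleMap (t x)) (hom_eq_zero_of_projective _)
    obtain ⟨v, rfl⟩ := S.map_surjective v
    refine ⟨v (1 : R), ?_⟩
    have : v ≫ g = t x := S.map_injective (by simpa using hv)
    rw [← ht x, ← this]
    rfl
  · intro x
    constructor
    · intro hx
      obtain ⟨v, hv⟩ := h.lift (singleMap (t x)) (by
        rw [← Functor.map_comp, ht', hx, ht0]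
        simp)
      obtain ⟨v, rfl⟩ := S.map_surjective v
      refine ⟨v (1 : R), ?_⟩
      have : v ≫ f = t x := S.map_injective (by simpa using hv)
      rw [← ht x, ← this]
      rfl
    · rintro ⟨y, rfl⟩
      exact ConcreteCategory.congr_hom hfg y

/-- An extension of complexes concentrated in degree `0` comes from an extension of modules. -/
lemma IsTri.exists_isSES {A B : ModuleCat.{u} R} {U : DerivedCategory (ModuleCat.{u} R)}
    {f : single A ⟶ U} {g : U ⟶ single B} {h : single B ⟶ (single A)⟦(1 : ℤ)⟧}
    (H : IsTri f g h) :
    ∃ (N : ModuleCat.{u} R) (a : A ⟶ N) (b : N ⟶ B) (e : U ≅ single N), IsSES a b ∧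
      f ≫ e.hom = singleMap a ∧ e.hom ≫ singleMap b = g := by
  have := H.isLE 0
  have := H.isGE 0
  obtain ⟨N, ⟨e⟩⟩ := U.exists_iso_singleFunctor_obj_of_isGE_of_isLE 0
  obtain ⟨a, ha⟩ := (singleFunctor (ModuleCat.{u} R) 0).map_surjective (f ≫ e.hom)
  obtain ⟨b, hb⟩ := (singleFunctor (ModuleCat.{u} R) 0).map_surjective (e.inv ≫ g)
  have H' := H.of_iso₂ e
  rw [← ha, ← hb] at H'
  exact ⟨N, a, b, e, isSES_of_isTri H', ha.symm, by rw [singleMap, hb]; simp⟩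

lemma hom_projective_eq_zero_of_isGP {G Q : ModuleCat.{u} R} (hG : IsGP G) (hQ : Projective Q)
    {n : ℤ} (hn : 0 < n) (f : single G ⟶ (single Q)⟦n⟧) : f = 0 := by
  obtain ⟨k, rfl⟩ : ∃ k : ℕ, ((k + 1 : ℕ) : ℤ) = n := ⟨(n - 1).toNat, by lia⟩
  obtain ⟨e, rfl⟩ := (Ext.homEquiv (X := G) (Y := Q) (n := k + 1)).surjective f
  rw [hG.ext Q hQ k e]
  exact Ext.zero_hom _ _ _

/-- Morphisms from a Gorenstein projective module to a positive shift of a module of finite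
projective dimension vanish. -/
lemma hom_eq_zero_of_isGP {G : ModuleCat.{u} R} (hG : IsGP G) {m : ℕ} {K : ModuleCat.{u} R}
    (hK : HasPdLE m K) {n : ℤ} (hn : 0 < n) (f : single G ⟶ (single K)⟦n⟧) : f = 0 := by
  induction m generalizing K n with
  | zero =>
    exact hom_projective_eq_zero_of_isGP hG hK.1 hn f
  | succ m ih =>
    obtain ⟨K', P, i, p, hS, hP, hK'⟩ := hK
    obtain ⟨δ, hδ⟩ := hS.exists_isTri
    let e := (shiftFunctorAdd' (DerivedCategory (ModuleCat.{u} R)) 1 n (n + 1)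
      (by lia)).app (single K')
    -- Dimension shifting: this composite lands in `K'⟦n + 1⟧`, so `f` factors through a positive
    -- shift of the projective `P`.
    have h0 : f ≫ δ⟦n⟧' = 0 := by
      rw [← cancel_mono e.inv, Category.assoc, ih hK' (n := n + 1) (by lia) (f ≫ δ⟦n⟧' ≫ e.inv)]
      simp
    obtain ⟨v, rfl⟩ := hδ.shift_lift₃ f h0
    rw [hom_projective_eq_zero_of_isGP hG hP.1 hn v, zero_comp]

section Homology

variable {X Y Z : DerivedCategory (ModuleCat.{u} R)} {f : X ⟶ Y} {g : Y ⟶ Z} {h : Z ⟶ X⟦(1 : ℤ)⟧}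

lemma IsTri.homology_iso₁ (H : IsTri f g h) (i : ℤ)
    (h₀ : IsZero ((homologyFunctor _ (i - 1)).obj Z)) (h₁ : IsZero ((homologyFunctor _ i).obj Z)) :
    Nonempty ((homologyFunctor _ i).obj X ≅ (homologyFunctor _ i).obj Y) := by
  have h₂ : Mono ((homologyFunctor _ i).map f) :=
    (HomologySequence.mono_homologyMap_mor₁_iff _ H (i - 1) i (by lia)).2 (h₀.eq_of_src _ _)
  have h₃ : Epi ((homologyFunctor _ i).map f) :=
    (HomologySequence.epi_homologyMap_mor₁_iff _ H i).2 (h₁.eq_of_tgt _ _)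
  have := isIso_of_mono_of_epi ((homologyFunctor _ i).map f)
  exact ⟨asIso ((homologyFunctor _ i).map f)⟩

lemma IsTri.homology_iso₂ (H : IsTri f g h) (i : ℤ)
    (h₀ : IsZero ((homologyFunctor _ i).obj X))
    (h₁ : IsZero ((homologyFunctor _ (i + 1)).obj X)) :
    Nonempty ((homologyFunctor _ i).obj Y ≅ (homologyFunctor _ i).obj Z) := by
  have h₂ : Mono ((homologyFunctor _ i).map g) :=
    (HomologySequence.mono_homologyMap_mor₂_iff _ H i).2 (h₀.eq_of_src _ _)
  have h₃ : Epi ((homologyFunctor _ i).map g) :=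
    (HomologySequence.epi_homologyMap_mor₂_iff _ H i (i + 1) (by lia)).2 (h₁.eq_of_tgt _ _)
  have := isIso_of_mono_of_epi ((homologyFunctor _ i).map g)
  exact ⟨asIso ((homologyFunctor _ i).map g)⟩

lemma homology_shift_iso (X : DerivedCategory (ModuleCat.{u} R)) (i k j : ℤ) (h : i + k = j) :
    Nonempty ((homologyFunctor _ i).obj (X⟦k⟧) ≅ (homologyFunctor _ j).obj X) :=
  ⟨((homologyFunctor (ModuleCat.{u} R) 0).shiftIso k i j (by lia)).app X⟩

lemma homology_single_iso (N : ModuleCat.{u} R) :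
    Nonempty ((homologyFunctor _ 0).obj (single N) ≅ N) :=
  ⟨(singleFunctorCompHomologyFunctorIso (ModuleCat.{u} R) 0).app N⟩

end Homology

end Derived

/-! ### The upper bound for the level of a complex. -/

section UpperBound

open DerivedCategory ZeroObject

variable {R : Type u} [CommRing R] [HasDerivedCategory.{w} (ModuleCat.{u} R)]

variable (R) in
/-- The complexes built in `n` steps from finitely generated Gorenstein projective modules. -/
noncomputable abbrev gIter (n : ℕ) : ObjectProperty (DerivedCategory (ModuleCat.{u} R)) :=
  ((fgGorensteinProjective R).map (singleFunctor (ModuleCat.{u} R) 0)).triangEnvelopeIter n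

lemma gIter_single {G : ModuleCat.{u} R} (hG : fgGorensteinProjective R G) (n : ℕ) :
    gIter R n (single G) :=
  ObjectProperty.le_triangEnvelopeIter _ n _ (ObjectProperty.prop_map_obj _ _ hG)

lemma gIter_of_isZero {Z : DerivedCategory (ModuleCat.{u} R)} (hZ : IsZero Z) (n : ℕ) :
    gIter R n Z :=
  triangEnvelopeIter_of_isZero (ObjectProperty.prop_map_obj _ _ fgGorensteinProjective_punit) hZ

lemma gIter_of_iso {n : ℕ} {X Y : DerivedCategory (ModuleCat.{u} R)} (e : X ≅ Y)
    (h : gIter R n X) : gIter R n Y :=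
  ObjectProperty.prop_of_iso _ e h

lemma gIter_of_hasGdimLE {n : ℕ} {N : ModuleCat.{u} R} (h : HasGdimLE n N) :
    gIter R n (single N) := by
  induction n generalizing N with
  | zero => exact gIter_single h 0
  | succ n ih =>
    obtain ⟨B, G, f, g, hS, hG, hB⟩ := h.exists_isSES
    obtain ⟨δ, hδ⟩ := hS.exists_isTri
    exact hδ.rotate.triangEnvelopeIter_succ (gIter_single hG 0)
      (triangEnvelopeIter_shift (ih hB) 1)

/-- The complexes with homology concentrated in degrees from `-n` to `0` and belonging to `𝒩`,
by means of their canonical filtration. -/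
def IsFiltered (𝒩 : ModuleCat.{u} R → Prop) : ℕ → DerivedCategory (ModuleCat.{u} R) → Prop
  | 0, M => ∃ N, 𝒩 N ∧ Nonempty (single N ≅ M)
  | n + 1, M => ∃ (Y : DerivedCategory (ModuleCat.{u} R)) (N : ModuleCat.{u} R)
      (f : Y⟦(1 : ℤ)⟧ ⟶ M) (g : M ⟶ single N) (h : single N ⟶ Y⟦(1 : ℤ)⟧⟦(1 : ℤ)⟧),
      IsTri f g h ∧ 𝒩 N ∧ IsFiltered 𝒩 n Y

namespace IsFiltered

variable {M : DerivedCategory (ModuleCat.{u} R)} {n : ℕ}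

lemma isLE {𝒩 : ModuleCat.{u} R → Prop} (h : IsFiltered 𝒩 n M) : M.IsLE 0 := by
  induction n generalizing M with
  | zero =>
    obtain ⟨N, -, ⟨e⟩⟩ := h
    exact TStructure.t.isLE_of_iso e 0
  | succ n ih =>
    obtain ⟨Y, N, f, g, h, H, -, hY⟩ := h
    have := ih hY
    have := isLE_zero_of_neg_one (Y⟦(1 : ℤ)⟧)
    exact H.isLE 0

/-- Only the top module changes: it is replaced by its extension by `B`, which keeps its Gorenstein
dimension within the bound. -/
lemma extend {d : ℕ} {Y W : DerivedCategory (ModuleCat.{u} R)} {B : ModuleCat.{u} R}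
    [IsNoetherianRing R]
    {f : Y ⟶ W} {g : W ⟶ single B} {h : single B ⟶ Y⟦(1 : ℤ)⟧} (H : IsTri f g h)
    (hY : IsFiltered (HasGdimLE d) n Y) (hB : fgGorensteinProjective R B) :
    IsFiltered (HasGdimLE d) n W := by
  cases n with
  | zero =>
    obtain ⟨N, hN, ⟨e⟩⟩ := hY
    obtain ⟨N', a, b, e', hS, -, -⟩ := (H.of_iso₁ e.symm).exists_isSES
    exact ⟨N', .mid hS hN hB, ⟨e'.symm⟩⟩
  | succ n =>
    obtain ⟨Y', N, f', g', h', H', hN, hY'⟩ := hY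
    obtain ⟨U, v, w, HU⟩ := IsTri.exists_cone (f' ≫ f)
    obtain ⟨m₁, m₃, -, -, -, -, Hm⟩ := IsTri.exists_octahedron H' H HU
    obtain ⟨N', a, b, e', hS, -, -⟩ := Hm.exists_isSES
    exact ⟨Y', N', _, _, _, HU.of_iso₃ e', .mid hS hN hB, hY'⟩

/-- Split off the top homology by the truncation triangle; the shift of the remaining part has one
homological degree fewer. -/
lemma of_homology {𝒩 : ModuleCat.{u} R → Prop} (h𝒩 : ∀ A B, Nonempty (A ≅ B) → 𝒩 A → 𝒩 B)
    (n : ℕ) (M : DerivedCategory (ModuleCat.{u} R)) [hle : M.IsLE 0] [hge : M.IsGE (-n : ℤ)]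
    (hM : ∀ i, 𝒩 ((homologyFunctor _ i).obj M)) : IsFiltered 𝒩 n M := by
  induction n generalizing M with
  | zero =>
    have : M.IsGE 0 := by simpa using hge
    obtain ⟨N, ⟨e⟩⟩ := M.exists_iso_singleFunctor_obj_of_isGE_of_isLE 0
    obtain ⟨e'⟩ := homology_single_iso (R := R) N
    exact ⟨N, h𝒩 _ _ ⟨(homologyFunctor _ 0).mapIso e ≪≫ e'⟩ (hM 0), ⟨e.symm⟩⟩
  | succ n ih =>
    obtain ⟨X, W, hX, hW, f, g, h, H⟩ := TStructure.t.exists_triangle M (-1) 0 (by lia)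
    replace H : IsTri f g h := H
    have hX : X.IsLE (-1) := ⟨hX⟩
    have hW : W.IsGE 0 := ⟨hW⟩
    have := isLE_zero_of_neg_one X
    have : X.IsLE (0 + 1) := TStructure.t.isLE_of_le X 0 _
    have : W.IsLE 0 := H.isLE₃ 0
    obtain ⟨N, ⟨e⟩⟩ := W.exists_iso_singleFunctor_obj_of_isGE_of_isLE 0
    obtain ⟨e'⟩ := homology_single_iso (R := R) N
    obtain ⟨e₀⟩ := H.homology_iso₂ 0 (X.isZero_of_isLE (-1) 0 (by lia))
      (X.isZero_of_isLE (-1) (0 + 1) (by lia))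
    have hXM (i : ℤ) (hi : i ≤ -1) :
        Nonempty ((homologyFunctor _ i).obj X ≅ (homologyFunctor _ i).obj M) :=
      H.homology_iso₁ i (W.isZero_of_isGE 0 (i - 1) (by lia)) (W.isZero_of_isGE 0 i (by lia))
    let Y := X⟦(-1 : ℤ)⟧
    let eX : Y⟦(1 : ℤ)⟧ ≅ X := shiftNegShift X 1
    have hY0 : Y.IsLE 0 := TStructure.t.isLE_shift X (-1) (-1) 0
    have hXY (i : ℤ) : Nonempty ((homologyFunctor _ i).obj Y ≅ (homologyFunctor _ (i - 1)).obj X) :=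
      homology_shift_iso X i (-1) (i - 1) (by lia)
    have hYn : Y.IsGE (-n : ℤ) := by
      rw [isGE_iff]
      intro i hi
      obtain ⟨a⟩ := hXY i
      obtain ⟨b⟩ := hXM (i - 1) (by lia)
      exact (M.isZero_of_isGE (-(n + 1 : ℕ) : ℤ) (i - 1) (by push_cast; lia)).of_iso (a ≪≫ b)
    refine ⟨Y, N, _, _, _, (H.of_iso₃ e).of_iso₁ eX.symm, ?_, ih Y fun i => ?_⟩
    · exact h𝒩 _ _ ⟨e₀ ≪≫ (homologyFunctor _ 0).mapIso e ≪≫ e'⟩ (hM 0)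
    · obtain ⟨a⟩ := hXY i
      by_cases hi : i ≤ 0
      · obtain ⟨b⟩ := hXM (i - 1) (by lia)
        exact h𝒩 _ _ ⟨(a ≪≫ b).symm⟩ (hM _)
      · exact h𝒩 _ _ ⟨(M.isZero_of_isLE 0 i (by lia)).iso (Y.isZero_of_isLE 0 i (by lia))⟩ (hM i)

end IsFiltered

section Step

variable {M Y : DerivedCategory (ModuleCat.{u} R)} {B P N : ModuleCat.{u} R}

/-- Covering the top homology of a complex by a projective module. -/
lemma exists_cover {a : Y⟦(1 : ℤ)⟧ ⟶ M} {π : M ⟶ single N}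
    {h : single N ⟶ Y⟦(1 : ℤ)⟧⟦(1 : ℤ)⟧} (H : IsTri a π h) [Y.IsLE 0] [Projective P]
    {i : B ⟶ P} {p : P ⟶ N} (hS : IsSES i p) :
    ∃ (W : DerivedCategory (ModuleCat.{u} R)) (e : W ⟶ single B) (m : single B ⟶ Y⟦(1 : ℤ)⟧)
      (w : Y⟦(1 : ℤ)⟧ ⟶ W⟦(1 : ℤ)⟧) (φ : single P ⟶ M) (t : M ⟶ W⟦(1 : ℤ)⟧),
      IsTri e m w ∧ IsTri φ t (-(e ≫ singleMap i)⟦(1 : ℤ)⟧') := by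
  have := isLE_zero_of_neg_one (Y⟦(1 : ℤ)⟧)
  -- The obstruction maps a projective into a complex with cohomology in negative degrees, so it
  -- vanishes.
  obtain ⟨φ, hφ⟩ := H.lift₃ (singleMap p) (hom_eq_zero_of_projective _)
  obtain ⟨W, j, t, HW⟩ := IsTri.exists_fiber φ
  obtain ⟨δ, hδ⟩ := hS.exists_isTri
  rw [← hφ] at hδ
  -- The octahedron of `φ ≫ π = p` relates the three fibres `W`, `single B` and `Y⟦1⟧`.
  obtain ⟨e, m, he, -, -, -, Hm⟩ := IsTri.exists_octahedron' HW H hδ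
  refine ⟨W, e, m, _, φ, t, Hm, ?_⟩
  rw [he]
  exact HW.rotate

/-- The fibre of `M ⟶ C⟦1⟧` is an extension of `F⟦1⟧` by `P` whose connecting map factors through `k
≫ e = 0`, so it splits. -/
lemma exists_isTri_biprod {W F C : DerivedCategory (ModuleCat.{u} R)} {e : W ⟶ single B}
    {i : B ⟶ P} {φ : single P ⟶ M} {t : M ⟶ W⟦(1 : ℤ)⟧}
    (H : IsTri φ t (-(e ≫ singleMap i)⟦(1 : ℤ)⟧'))
    {k : F ⟶ W} {q : W ⟶ C} {v : C ⟶ F⟦(1 : ℤ)⟧} (Hk : IsTri k q v) (hk : k ≫ e = 0) :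
    ∃ (f : single P ⊞ F⟦(1 : ℤ)⟧ ⟶ M) (g : M ⟶ C⟦(1 : ℤ)⟧) (h : _), IsTri f g h := by
  obtain ⟨K, x, y, HK⟩ := IsTri.exists_fiber (t ≫ q⟦(1 : ℤ)⟧')
  obtain ⟨m₁, m₃, -, -, -, -, Hm⟩ := IsTri.exists_octahedron' H Hk.shift HK
  obtain ⟨e', -, -⟩ := Hm.split (by
    rw [Preadditive.comp_neg, ← Functor.map_comp, ← Category.assoc, hk, zero_comp,
      Functor.map_zero, neg_zero])
  exact ⟨_, _, _, HK.of_iso₁ e'⟩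

end Step

section TwoSteps

/-- `M` is the cone of a morphism between complexes built in `0` steps, in a way that makes it
possible to continue with an extension. -/
def HasSplitting (M : DerivedCategory (ModuleCat.{u} R)) : Prop :=
  ∃ (X : ModuleCat.{u} R) (Z C : DerivedCategory (ModuleCat.{u} R)) (f : single X ⊞ Z ⟶ M)
    (g : M ⟶ C) (h : C ⟶ (single X ⊞ Z)⟦(1 : ℤ)⟧), IsTri f g h ∧ fgGorensteinProjective R X ∧
      Z.IsLE (-1) ∧ gIter R 0 Z ∧ C.IsLE (-1) ∧ gIter R 0 C

variable {M W Y : DerivedCategory (ModuleCat.{u} R)} {B : ModuleCat.{u} R}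

lemma HasSplitting.gIter_one (h : HasSplitting M) : gIter R 1 M := by
  obtain ⟨X, Z, C, f, g, h, H, hX, -, hZ, -, hC⟩ := h
  exact H.triangEnvelopeIter_succ (triangEnvelopeIter_zero_biprod (gIter_single hX 0) hZ) hC

lemma HasSplitting.of_iso {M' : DerivedCategory (ModuleCat.{u} R)} (e : M ≅ M')
    (h : HasSplitting M) : HasSplitting M' := by
  obtain ⟨X, Z, C, f, g, h, H, hX⟩ := h
  exact ⟨X, Z, C, _, _, _, H.of_iso₂ e, hX⟩

lemma hasSplitting_single {N : ModuleCat.{u} R} (hN : HasGdimLE 1 N) :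
    HasSplitting (single N) := by
  obtain ⟨B, G, f, g, hS, hG, hB⟩ := hN.exists_isSES
  obtain ⟨δ, hδ⟩ := hS.exists_isTri
  have h0 : IsZero (0 : DerivedCategory (ModuleCat.{u} R)) := isZero_zero _
  let e : single G ≅ single G ⊞ 0 := isoBiprodZero h0
  refine ⟨G, 0, (single B)⟦(1 : ℤ)⟧, _, _, _, hδ.rotate.of_iso₁ e, hG, ?_, gIter_of_isZero h0 0,
    inferInstance, triangEnvelopeIter_shift (gIter_single hB 0) 1⟩
  rw [isLE_iff]
  exact fun i _ => Functor.map_isZero _ h0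

/-- If `W` admits a splitting and `e : W ⟶ single B` is surjective on `H₀`, then `W` is the cone
of a morphism between complexes built in `0` steps, in a way that is compatible with `e`. -/
lemma HasSplitting.exists_isTri [IsNoetherianRing R] (hW : HasSplitting W)
    (hB : fgGorensteinProjective R B) {e : W ⟶ single B} {m : single B ⟶ Y⟦(1 : ℤ)⟧}
    {w : Y⟦(1 : ℤ)⟧ ⟶ W⟦(1 : ℤ)⟧} [Y.IsLE 0] (He : IsTri e m w) :
    ∃ (F C : DerivedCategory (ModuleCat.{u} R)) (k : F ⟶ W) (q : W ⟶ C) (v : C ⟶ F⟦(1 : ℤ)⟧),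
      IsTri k q v ∧ k ≫ e = 0 ∧ F.IsLE 0 ∧ gIter R 0 F ∧ C.IsLE 0 ∧ gIter R 0 C := by
  obtain ⟨X, Z, C', f, g, h, H, hX, hZle, hZ, hCle, hC⟩ := hW
  obtain ⟨α, hα⟩ := (singleFunctor (ModuleCat.{u} R) 0).map_surjective (biprod.inl ≫ f ≫ e)
  have hfe : f ≫ e = biprod.fst ≫ singleMap α := by
    ext
    · simp [hα]
    · rw [hom_eq_zero_of_isLE (biprod.inr ≫ f ≫ e)]
      simp
  -- A map from `B` that vanishes on `X` factors through `C'` and then through `Y⟦1⟧`; neither has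
  -- nonzero maps to a module.
  have hαe : Epi α := by
    rw [Preadditive.epi_iff_cancel_zero]
    intro Q q hq
    have h₁ : f ≫ e ≫ singleMap q = 0 := by
      rw [← Category.assoc, hfe, Category.assoc, ← Functor.map_comp, hq, Functor.map_zero,
        comp_zero]
    obtain ⟨x, hx⟩ := H.desc _ h₁
    rw [hom_eq_zero_of_isLE x, comp_zero] at hx
    obtain ⟨y, hy⟩ := He.desc _ hx.symm
    rw [hom_eq_zero_of_isLE y, comp_zero] at hy
    exact (singleFunctor (ModuleCat.{u} R) 0).map_injective (by simpa using hy.symm)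
  have hS := isSES_ker α ((ModuleCat.epi_iff_surjective α).1 hαe)
  set X₁ := ModuleCat.of R (LinearMap.ker α.hom)
  have hX₁ : fgGorensteinProjective R X₁ := .left hS hX hB
  obtain ⟨δ, hδ⟩ := hS.exists_isTri
  have hfst : IsTri (biprod.inr : Z ⟶ single X ⊞ Z) biprod.fst 0 :=
    (IsTri.biprod Z (single X)).of_iso (Iso.refl _) (biprod.braiding _ _) (Iso.refl _)
      (by ext <;> simp) (by simp) (by simp)
  -- Replacing `X` by `ker α` forces `F ⟶ W ⟶ B` to vanish; `F` is still a sum of `Z` and a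
  -- Gorenstein projective module.
  obtain ⟨F, k, y, HF⟩ := IsTri.exists_fiber (biprod.fst ≫ singleMap α : single X ⊞ Z ⟶ single B)
  obtain ⟨a₁, a₃, -, -, -, -, HF'⟩ := IsTri.exists_octahedron' hfst hδ HF
  obtain ⟨eF, -, -⟩ := HF'.split comp_zero
  have hF : gIter R 0 F :=
    gIter_of_iso eF.symm (triangEnvelopeIter_zero_biprod hZ (gIter_single hX₁ 0))
  have hFle : F.IsLE 0 := by
    have := isLE_zero_of_neg_one Z
    exact HF'.isLE 0
  rw [← hfe] at HF
  obtain ⟨C, q, v, HC⟩ := IsTri.exists_cone (k ≫ f)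
  obtain ⟨m₁, m₃, h₁, -, -, -, Hm⟩ := IsTri.exists_octahedron HF H HC
  have hke : (k ≫ f) ≫ e = 0 := by rw [Category.assoc, HF.zero₁₂]
  -- Since `e` vanishes on `F` it factors through `C`; this factorization retracts `C` onto `B`, so
  -- `C` is the sum of `B` and `C'`.
  obtain ⟨r, hr⟩ := HC.desc e hke
  have hmr : m₁ ≫ r = 𝟙 _ := by
    have h₂ : (f ≫ e) ≫ (m₁ ≫ r - 𝟙 _) = 0 := by
      rw [Preadditive.comp_sub, ← Category.assoc, h₁, Category.assoc, hr, Category.comp_id,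
        sub_self]
    obtain ⟨x, hx⟩ := HF.desc₃ _ h₂
    rw [hom_eq_zero_of_isLE x, comp_zero] at hx
    exact (sub_eq_zero.1 hx.symm)
  have hmono : Mono m₁ := mono_of_mono_fac hmr
  obtain ⟨eC, -, -⟩ := Hm.split (Pretriangulated.Triangle.mor₃_eq_zero_of_mono₁ _ Hm hmono)
  refine ⟨F, C, _, q, v, HC, hke, hFle, hF, ?_,
    gIter_of_iso eC.symm (triangEnvelopeIter_zero_biprod (gIter_single hB 0) hC)⟩
  have := isLE_zero_of_neg_one C'
  exact Hm.isLE 0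

/-- Dimension at most 1 makes `B` Gorenstein projective. Hence `W`, an extension of `B` by `Y`,
stays within the hypothesis and the induction applies to `W` itself. -/
lemma IsFiltered.hasSplitting [IsNoetherianRing R] {n : ℕ}
    (h : IsFiltered (HasGdimLE 1) n M) : HasSplitting M := by
  induction n generalizing M with
  | zero =>
    obtain ⟨N, hN, ⟨e⟩⟩ := h
    exact (hasSplitting_single hN).of_iso e
  | succ n ih =>
    obtain ⟨Y, N, a, π, h, H, hN, hY⟩ := h
    have := hY.isLE
    have := hN.finite
    obtain ⟨B, P, i, p, _, _, _, hS⟩ := exists_isSES_of_finite N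
    have hB : fgGorensteinProjective R B :=
      HasGdimLE.syzygy (n := 0) hS (fgGorensteinProjective_of_projective P) hN
    obtain ⟨W, e, m, w, φ, t, He, Ht⟩ := exists_cover H hS
    obtain ⟨f, -, Hf⟩ := He.exists_unrotate
    obtain ⟨F, C, k, q, v, Hk, hke, _, hF, _, hC⟩ := (ih (hY.extend Hf hB)).exists_isTri hB He
    obtain ⟨x, y, z, Hx⟩ := exists_isTri_biprod Ht Hk hke
    exact ⟨P, _, _, x, y, z, Hx, fgGorensteinProjective_of_projective P, inferInstance,
      triangEnvelopeIter_shift hF 1, inferInstance, triangEnvelopeIter_shift hC 1⟩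

/-- Lowering the Gorenstein dimension of the homology by one. -/
lemma IsFiltered.exists_isTri [IsNoetherianRing R] {d n : ℕ}
    (h : IsFiltered (HasGdimLE (d + 1)) n M) :
    ∃ (F C : DerivedCategory (ModuleCat.{u} R)) (f : F ⟶ M) (g : M ⟶ C⟦(1 : ℤ)⟧) (h : _),
      IsTri f g h ∧ gIter R 0 F ∧ IsFiltered (HasGdimLE d) n C := by
  induction n generalizing M with
  | zero =>
    obtain ⟨N, hN, ⟨e⟩⟩ := h
    obtain ⟨B, G, f, g, hS, hG, hB⟩ := hN.exists_isSES
    obtain ⟨δ, hδ⟩ := hS.exists_isTri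
    exact ⟨_, _, _, _, _, hδ.rotate.of_iso₂ e, gIter_single hG 0, B, hB, ⟨Iso.refl _⟩⟩
  | succ n ih =>
    obtain ⟨Y, N, a, π, h, H, hN, hY⟩ := h
    have := hY.isLE
    have := hN.finite
    obtain ⟨B, P, i, p, _, _, _, hS⟩ := exists_isSES_of_finite N
    have hB : HasGdimLE d B := HasGdimLE.syzygy hS (fgGorensteinProjective_of_projective P) hN
    obtain ⟨W, e, m, w, φ, t, He, Ht⟩ := exists_cover H hS
    obtain ⟨F, C', f, g, h', Hf, hF, hC'⟩ := ih hY
    -- `C` has top module `B` and lower part `C'⟦1⟧`, glued so that the octahedron yields `F ⟶ W ⟶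
    -- C`. The first map factors through `Y ⟶ W`, so `e` kills it.
    obtain ⟨C, x, y, HC⟩ := IsTri.exists_middle (m ≫ g⟦(1 : ℤ)⟧')
    obtain ⟨m₁, m₃, -, -, -, -, Hm⟩ := IsTri.exists_octahedron' He Hf.shift HC.rotate
    obtain ⟨k, hk, Hk⟩ := Hm.exists_unrotate
    have hke : k ≫ e = 0 := by
      apply (shiftFunctor _ (1 : ℤ)).map_injective
      rw [Functor.map_comp, hk, Preadditive.neg_comp, Category.assoc, He.zero₃₁]
      simp
    obtain ⟨x', y', z', Hx⟩ := exists_isTri_biprod Ht Hk hke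
    exact ⟨_, C, x', y', z', Hx, triangEnvelopeIter_zero_biprod
      (gIter_single (fgGorensteinProjective_of_projective P) 0) (triangEnvelopeIter_shift hF 1),
      C', B, _, _, _, HC, hB, hC'⟩

/-- The induction must stop at dimension 1: a complex with Gorenstein projective homology need not
lie in `gIter R 0`. -/
lemma IsFiltered.gIter [IsNoetherianRing R] {d n : ℕ}
    (h : IsFiltered (HasGdimLE (d + 1)) n M) : gIter R (d + 1) M := by
  induction d generalizing M with
  | zero => exact h.hasSplitting.gIter_one
  | succ d ih =>
    obtain ⟨F, C, f, g, h, H, hF, hC⟩ := h.exists_isTri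
    exact H.triangEnvelopeIter_succ hF (triangEnvelopeIter_shift (ih hC) 1)

end TwoSteps

lemma gIter_of_homology [IsNoetherianRing R] (M : DerivedCategory (ModuleCat.{u} R))
    (hM : TStructure.t.bounded M) {d : ℕ}
    (h : ∀ i, HasGdimLE (d + 1) ((homologyFunctor _ i).obj M)) : gIter R (d + 1) M := by
  obtain ⟨⟨a, ha⟩, ⟨b, hb⟩⟩ := hM
  have hb' : (M⟦b⟧).IsLE 0 := TStructure.t.isLE_shift M b b 0
  have ha' : (M⟦b⟧).IsGE (a - b) := TStructure.t.isGE_shift M a b (a - b)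
  -- If `b < a`, `toNat` gives `0`, still a lower bound since then `0 < a - b`.
  have ha'' : (M⟦b⟧).IsGE (-((b - a).toNat : ℕ) : ℤ) :=
    TStructure.t.isGE_of_ge (M⟦b⟧) _ (a - b) (by lia)
  have := IsFiltered.of_homology (𝒩 := HasGdimLE (d + 1)) (fun A B ⟨e⟩ hA => hA.of_iso e)
    (b - a).toNat (M⟦b⟧)
    (fun i => (h (i + b)).of_iso (homology_shift_iso M i b _ rfl).some.symm)
  exact gIter_of_iso ((shiftShiftNeg M b)) (triangEnvelopeIter_shift this.gIter (-b))

end UpperBound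

/-! ### Finiteness of the Gorenstein dimension for modules of finite level. -/

section Truncation

open DerivedCategory ZeroObject

variable {R : Type u} [CommRing R] [HasDerivedCategory.{w} (ModuleCat.{u} R)]

/-- Every morphism to a complex with homology concentrated in nonpositive cohomological degrees
vanishes. -/
def IsOrthogonal (Q : DerivedCategory (ModuleCat.{u} R)) : Prop :=
  ∀ (X : DerivedCategory (ModuleCat.{u} R)) (_ : X.IsLE 0) (f : Q ⟶ X), f = 0

lemma IsOrthogonal.of_isTri {X Y Z : DerivedCategory (ModuleCat.{u} R)} {f : X ⟶ Y} {g : Y ⟶ Z}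
    {h : Z ⟶ X⟦(1 : ℤ)⟧} (H : IsTri f g h) (hX : IsOrthogonal X) (hZ : IsOrthogonal Z) :
    IsOrthogonal Y := by
  intro W hW u
  obtain ⟨v, rfl⟩ := H.desc u (hX W hW _)
  rw [hZ W hW v, comp_zero]

/-- `M` is an extension of the module `A` by a complex without morphisms to nonpositive
complexes. -/
def IsTruncated (A : ModuleCat.{u} R) (M : DerivedCategory (ModuleCat.{u} R)) : Prop :=
  ∃ (Q : DerivedCategory (ModuleCat.{u} R)) (f : Q ⟶ M) (g : M ⟶ single A)
    (h : single A ⟶ Q⟦(1 : ℤ)⟧), IsTri f g h ∧ IsOrthogonal Q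

lemma isTruncated_single (A : ModuleCat.{u} R) : IsTruncated A (single A) :=
  ⟨0, 0, 𝟙 _, 0, Pretriangulated.contractible_distinguished₁ _,
    fun _ _ _ => (isZero_zero _).eq_of_src _ _⟩

lemma IsTruncated.of_iso {A : ModuleCat.{u} R} {M M' : DerivedCategory (ModuleCat.{u} R)}
    (h : IsTruncated A M) (e : M ≅ M') : IsTruncated A M' := by
  obtain ⟨Q, f, g, h, H, hQ⟩ := h
  exact ⟨Q, _, _, _, H.of_iso₂ e, hQ⟩

/-- The new orthogonal part is a shift of an extension of `P` by `Q`; both have no maps to complexes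
in degrees at most `-1`. -/
lemma IsTruncated.syzygy {A' P A : ModuleCat.{u} R} {M : DerivedCategory (ModuleCat.{u} R)}
    (h : IsTruncated A M) [Projective P] {k : A' ⟶ P} {p : P ⟶ A} (hS : IsSES k p) :
    IsTruncated A' (M⟦(-1 : ℤ)⟧) := by
  obtain ⟨Q, f, g, h, H, hQ⟩ := h
  obtain ⟨δ, hδ⟩ := hS.exists_isTri
  obtain ⟨Q', x, y, HQ'⟩ := IsTri.exists_fiber (g ≫ δ)
  obtain ⟨m₁, m₃, -, -, -, -, Hm⟩ := IsTri.exists_octahedron' H hδ.rotate HQ'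
  obtain ⟨x', y', z', H'⟩ := HQ'.exists_shift (-1)
  refine ⟨_, _, _, _, H'.of_iso₃ (shiftShiftNeg (single A') (1 : ℤ)), ?_⟩
  intro X hX u
  obtain ⟨v, hv⟩ : ∃ v, v = (shiftNegShift Q' (1 : ℤ)).inv ≫ u⟦(1 : ℤ)⟧' := ⟨_, rfl⟩
  have h₁ : m₁ ≫ v = 0 := hQ _ (isLE_zero_of_neg_one _) _
  obtain ⟨t, rfl⟩ := Hm.desc v h₁
  rw [hom_eq_zero_of_projective t, comp_zero] at hv
  apply (shiftFunctor _ (1 : ℤ)).map_injective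
  rw [← cancel_epi (shiftNegShift Q' (1 : ℤ)).inv, ← hv, Functor.map_zero, comp_zero]

/-- A horseshoe lemma: the connecting map followed by `X⟦1⟧ ⟶ A⟦1⟧` kills `Q₂`, hence descends to `θ
: B ⟶ A⟦1⟧`, which defines `E`. -/
lemma IsTruncated.extension {A B : ModuleCat.{u} R} {X M Y : DerivedCategory (ModuleCat.{u} R)}
    (hA : IsTruncated A X) (hB : IsTruncated B Y) {f : X ⟶ M} {g : M ⟶ Y} {h : Y ⟶ X⟦(1 : ℤ)⟧}
    (H : IsTri f g h) :
    ∃ (E : ModuleCat.{u} R) (i : A ⟶ E) (p : E ⟶ B), IsSES i p ∧ IsTruncated E M := by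
  obtain ⟨Q₁, a₁, b₁, c₁, H₁, hQ₁⟩ := hA
  obtain ⟨Q₂, a₂, b₂, c₂, H₂, hQ₂⟩ := hB
  obtain ⟨U, x, y, HU⟩ := IsTri.exists_cone (a₁ ≫ f)
  obtain ⟨m₁, m₃, -, -, -, -, Hm⟩ := IsTri.exists_octahedron H₁ H HU
  have := isLE_zero_of_neg_one ((single A)⟦(1 : ℤ)⟧)
  obtain ⟨θ, hθ⟩ := H₂.desc (h ≫ b₁⟦(1 : ℤ)⟧') (hQ₂ _ this _)
  obtain ⟨V, i, p, HV⟩ := IsTri.exists_middle θ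
  rw [← hθ] at Hm
  obtain ⟨n₁, n₃, -, -, -, -, Hn⟩ := IsTri.exists_octahedron' H₂ HV.rotate Hm.rotate
  obtain ⟨E, i', p', e, hS, -, -⟩ := HV.exists_isSES
  obtain ⟨Q, s, t, HQ⟩ := IsTri.exists_fiber (x ≫ n₃)
  obtain ⟨l₁, l₃, -, -, -, -, Hl⟩ := IsTri.exists_octahedron' HU Hn HQ
  exact ⟨E, i', p', hS, Q, _, _, _, HQ.of_iso₃ e, .of_isTri Hl hQ₁ hQ₂⟩

variable (R) in
/-- The complexes that have, up to a shift, a Gorenstein projective truncation. -/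
def gTruncated : ObjectProperty (DerivedCategory (ModuleCat.{u} R)) :=
  fun M => ∃ (s : ℤ) (G : ModuleCat.{u} R), IsGP G ∧ IsTruncated G (M⟦s⟧)

/-- Syzygies of Gorenstein projectives remain Gorenstein projective. This brings two objects with
different shifts to a common one. -/
lemma IsTruncated.exists_isGP {s t : ℤ} (hst : t ≤ s) {M : DerivedCategory (ModuleCat.{u} R)}
    {G : ModuleCat.{u} R} (hG : IsGP G) (h : IsTruncated G (M⟦s⟧)) :
    ∃ G', IsGP G' ∧ IsTruncated G' (M⟦t⟧) := by
  obtain ⟨n, rfl⟩ := Int.exists_add_of_le hst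
  induction n generalizing G t with
  | zero => exact ⟨G, hG, by simpa using h⟩
  | succ n ih =>
    have h' : IsTruncated G (M⟦(t + 1) + (n : ℤ)⟧) := by
      rwa [show t + 1 + (n : ℤ) = t + ((n + 1 : ℕ) : ℤ) by push_cast; ring]
    obtain ⟨G', hG', h''⟩ := ih hG (by lia) h'
    obtain ⟨K, P, k, p, hP, hS⟩ := exists_isSES_of_projective G'
    exact ⟨K, .left hS (.of_projective P) hG', (h''.syzygy hS).of_iso
      ((shiftFunctorAdd' _ (t + 1) (-1) t (by lia)).symm.app M)⟩

instance : (gTruncated R).IsClosedUnderIsomorphisms where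
  of_iso e := fun ⟨s, G, hG, h⟩ => ⟨s, G, hG, h.of_iso ((shiftFunctor _ s).mapIso e)⟩

instance : (gTruncated R).IsTriangulated where
  exists_zero := ⟨0, isZero_zero _, 0, ModuleCat.of R PUnit, .of_projective _,
    (isTruncated_single _).of_iso (IsZero.iso
      (Functor.map_isZero _ (ModuleCat.isZero_of_subsingleton _))
      (Functor.map_isZero _ (isZero_zero _)))⟩
  isStableUnderShiftBy a := ⟨fun M ⟨s, G, hG, h⟩ => ⟨s - a, G, hG, h.of_iso
    ((shiftFunctorAdd' _ a (s - a) s (by lia)).app M)⟩⟩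
  toIsTriangulatedClosed₂ := .mk' fun T hT ⟨s, G, hG, h⟩ ⟨s', G', hG', h'⟩ => by
    obtain ⟨G, hG, h⟩ := h.exists_isGP (min_le_left s s') hG
    obtain ⟨G', hG', h'⟩ := h'.exists_isGP (min_le_right s s') hG'
    obtain ⟨f, g, δ, H⟩ := IsTri.exists_shift hT (min s s')
    obtain ⟨E, i, p, hS, hE⟩ := h.extension h' H
    exact ⟨_, E, .mid hS hG hG', hE⟩

instance : (gTruncated R).retractClosure.IsTriangulated where
  exists_zero := ⟨0, isZero_zero _, ObjectProperty.le_retractClosure _ _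
    (ObjectProperty.prop_zero _)⟩
  isStableUnderShiftBy a := ⟨fun M ⟨M', hM', ⟨r⟩⟩ =>
    ⟨_, ObjectProperty.le_shift _ a _ hM', ⟨r.map (shiftFunctor _ a)⟩⟩⟩
  toIsTriangulatedClosed₂ := .mk' fun T hT h₁ h₃ => by
    obtain ⟨M', ⟨A, B, f, g, h, H, hA, hB⟩, hr⟩ :=
      ObjectProperty.extensionProduct_retractClosure_retractClosure_le _ _ _
        ⟨_, _, _, _, _, hT, h₁, h₃⟩
    exact ⟨M', ObjectProperty.ext_of_isTriangulatedClosed₂ _ _ H hA hB, hr⟩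

lemma gIter_le_gTruncated (n : ℕ) : gIter R n ≤ (gTruncated R).retractClosure := by
  refine (ObjectProperty.triangEnvelopeIter_le_triangEnvelope _ n).trans ?_
  rw [ObjectProperty.triangEnvelope_le_iff]
  rintro M ⟨G, hG, ⟨e⟩⟩
  exact ObjectProperty.le_retractClosure _ _ ⟨0, G, hG.isGP, (isTruncated_single G).of_iso
    (e ≪≫ (shiftFunctorZero _ ℤ).symm.app M)⟩

lemma exists_isTruncated_of_finite [IsNoetherianRing R] (N : ModuleCat.{u} R) [Module.Finite R N]
    (t : ℕ) : ∃ A : ModuleCat.{u} R, Module.Finite R A ∧ IsTruncated A ((single N)⟦(-t : ℤ)⟧) ∧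
      ∀ m, HasGdimLE m A → HasGdimLE (t + m) N := by
  induction t with
  | zero =>
    refine ⟨N, ‹_›, (isTruncated_single N).of_iso
      ((shiftFunctorZero' _ _ (by simp)).symm.app _), ?_⟩
    intro m hm
    rwa [zero_add]
  | succ t ih =>
    obtain ⟨A, hA, h, h'⟩ := ih
    obtain ⟨K, P, k, p, _, _, hK, hS⟩ := exists_isSES_of_finite A
    refine ⟨K, hK, (h.syzygy hS).of_iso
      ((shiftFunctorAdd' _ (-t : ℤ) (-1) _ (by push_cast; ring)).symm.app _), fun m hm => ?_⟩
    have := h' _ (.succ hS (fgGorensteinProjective_of_projective P) hm)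
    rwa [add_assoc, add_comm 1 m]

/-- Maps of complexes induce maps of truncations, and `𝟙 A - α ≫ β` factors through a projective: it
factors through `Q₁⟦1⟧`, which has no maps to `K⟦1⟧⟦1⟧... ` up to the shift of a complex in degrees
at most 0, so it lifts to `P`. Thus `A` is a summand of `B × P`. -/
lemma IsTruncated.exists_factorization {A B : ModuleCat.{u} R}
    {X Y : DerivedCategory (ModuleCat.{u} R)} (hA : IsTruncated A X) (hB : IsTruncated B Y)
    (r : Retract X Y) :
    ∃ (α : A ⟶ B) (β : B ⟶ A) (P : ModuleCat.{u} R) (_ : Projective P) (γ : A ⟶ P) (π : P ⟶ A),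
      α ≫ β + γ ≫ π = 𝟙 A := by
  obtain ⟨Q₁, a₁, b₁, c₁, H₁, hQ₁⟩ := hA
  obtain ⟨Q₂, a₂, b₂, c₂, H₂, hQ₂⟩ := hB
  let S := singleFunctor (ModuleCat.{u} R) 0
  obtain ⟨α, hα⟩ := H₁.desc (r.i ≫ b₂) (hQ₁ _ inferInstance _)
  obtain ⟨β, hβ⟩ := H₂.desc (r.r ≫ b₁) (hQ₂ _ inferInstance _)
  obtain ⟨α, rfl⟩ := S.map_surjective α
  obtain ⟨β, rfl⟩ := S.map_surjective β
  obtain ⟨K, P, k, p, hP, hS⟩ := exists_isSES_of_projective A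
  obtain ⟨δ, hδ⟩ := hS.exists_isTri
  have h₁ : b₁ ≫ S.map (𝟙 A - α ≫ β) = 0 := by
    rw [Functor.map_sub, Functor.map_comp, Preadditive.comp_sub, ← Category.assoc, hα,
      Category.assoc, hβ, r.retract_assoc, S.map_id]
    exact sub_eq_zero.2 (Category.comp_id b₁)
  obtain ⟨x, hx⟩ := H₁.desc₃ _ h₁
  have h₂ : S.map (𝟙 A - α ≫ β) ≫ δ = 0 := by
    rw [← hx, Category.assoc]
    obtain ⟨y, hy⟩ := (shiftFunctor _ (1 : ℤ)).map_surjective (x ≫ δ)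
    rw [← hy, hQ₁ _ inferInstance y]
    simp
  obtain ⟨γ, hγ⟩ := hδ.lift₃ _ h₂
  obtain ⟨γ, rfl⟩ := S.map_surjective γ
  refine ⟨α, β, P, hP, γ, p, ?_⟩
  have : γ ≫ p = 𝟙 A - α ≫ β := S.map_injective (by rw [Functor.map_comp]; exact hγ)
  rw [this]
  abel

/-- A finitely generated module that can be built from finitely generated Gorenstein projective
modules has finite Gorenstein dimension. -/
lemma exists_hasGdimLE_of_gIter [IsNoetherianRing R] {n : ℕ} {N : ModuleCat.{u} R}
    [Module.Finite R N] (h : gIter R n (single N)) : ∃ m, HasGdimLE m N := by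
  obtain ⟨X, ⟨s, G, hG, hX⟩, ⟨r⟩⟩ := gIter_le_gTruncated n _ h
  let t := s.natAbs
  obtain ⟨G, hG, hX⟩ := hX.exists_isGP (t := -t) (by lia) hG
  obtain ⟨A, hA, hN, h'⟩ := exists_isTruncated_of_finite N t
  obtain ⟨α, β, P, hP, γ, π, h₁⟩ := hN.exists_factorization hX (r.map (shiftFunctor _ (-t : ℤ)))
  refine ⟨_, h' 0 ((fgGorensteinProjective_iff A).2 ⟨hA, ?_⟩)⟩
  refine IsGP.of_retract (X := A) (Y := ModuleCat.of R (G × P))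
    (ModuleCat.ofHom (LinearMap.prod α.hom γ.hom))
    (ModuleCat.ofHom (LinearMap.coprod β.hom π.hom)) ?_ (.prod hG (.of_projective P))
  rw [← h₁]
  ext x
  simp

end Truncation

/-! ### Ghost maps and the lower bound for the level of a module. -/

section Ghost

open DerivedCategory

variable {R : Type u} [CommRing R] [HasDerivedCategory.{w} (ModuleCat.{u} R)]

/-- Morphisms that vanish after composition with every morphism from a complex built in `0` steps
from finitely generated Gorenstein projective modules. -/
def IsGhost {X Y : DerivedCategory (ModuleCat.{u} R)} (f : X ⟶ Y) : Prop :=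
  ∀ (A : DerivedCategory (ModuleCat.{u} R)) (_ : gIter R 0 A) (u : A ⟶ X), u ≫ f = 0

/-- Composites of `n` ghosts followed by a morphism. -/
def IsGhostComp : ∀ (_ : ℕ) {X Y : DerivedCategory (ModuleCat.{u} R)} (_ : X ⟶ Y), Prop
  | 0, _, _, _ => True
  | n + 1, X, Y, f => ∃ (W : DerivedCategory (ModuleCat.{u} R)) (g : X ⟶ W) (h : W ⟶ Y),
      IsGhost g ∧ IsGhostComp n h ∧ g ≫ h = f

lemma IsGhost.shift {X Y : DerivedCategory (ModuleCat.{u} R)} {f : X ⟶ Y} (hf : IsGhost f)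
    (n : ℤ) : IsGhost (f⟦n⟧') := by
  intro A hA u
  let e : (A⟦-n⟧)⟦n⟧ ≅ A := shiftNegShift A n
  obtain ⟨v, hv⟩ := (shiftFunctor _ n).map_surjective (e.hom ≫ u)
  rw [← cancel_epi e.hom, ← Category.assoc, ← hv, ← Functor.map_comp,
    hf _ (triangEnvelopeIter_shift hA (-n)) v]
  simp

lemma isGhost_of_shift {X Y : DerivedCategory (ModuleCat.{u} R)} {f : X ⟶ Y}
    (h : ∀ (G : ModuleCat.{u} R) (_ : fgGorensteinProjective R G) (n : ℤ)
      (u : (single G)⟦n⟧ ⟶ X), u ≫ f = 0) : IsGhost f := by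
  let Q : ObjectProperty (DerivedCategory (ModuleCat.{u} R)) := fun A => ∀ u : A ⟶ X, u ≫ f = 0
  have : Q.IsStableUnderRetracts := ⟨fun r hY u => by
    rw [← Category.id_comp u, ← r.retract, Category.assoc, Category.assoc, ← Category.assoc r.r,
      hY, comp_zero]⟩
  have hQ : gIter R 0 ≤ Q := by
    refine triangEnvelopeIter_zero_le ?_ ?_
    · rintro A n ⟨G, hG, ⟨e⟩⟩ u
      rw [← cancel_epi (e.hom⟦n⟧'), ← Category.assoc, h G hG n, comp_zero]
    · intro A B hA hB u
      ext
      · rw [← Category.assoc, hA, comp_zero]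
      · rw [← Category.assoc, hB, comp_zero]
  exact hQ

namespace IsGhostComp

variable {X Y Z : DerivedCategory (ModuleCat.{u} R)} {f : X ⟶ Y} {n : ℕ}

lemma comp (hf : IsGhostComp n f) (g : Y ⟶ Z) : IsGhostComp n (f ≫ g) := by
  induction n generalizing X with
  | zero => trivial
  | succ n ih =>
    obtain ⟨W, a, b, ha, hb, rfl⟩ := hf
    exact ⟨W, a, b ≫ g, ha, ih hb, (Category.assoc _ _ _).symm⟩

lemma shift (hf : IsGhostComp n f) (k : ℤ) : IsGhostComp n (f⟦k⟧') := by
  induction n generalizing X with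
  | zero => trivial
  | succ n ih =>
    obtain ⟨W, a, b, ha, hb, rfl⟩ := hf
    exact ⟨_, _, _, ha.shift k, ih hb, (Functor.map_comp _ _ _).symm⟩

lemma mono {m : ℕ} (hmn : m ≤ n) (hf : IsGhostComp n f) : IsGhostComp m f := by
  induction m generalizing X n with
  | zero => trivial
  | succ m ih =>
    obtain ⟨n, rfl⟩ := Nat.exists_eq_add_of_le' (Nat.one_le_of_lt hmn)
    obtain ⟨W, a, b, ha, hb, rfl⟩ := hf
    exact ⟨W, a, b, ha, ih (by lia) hb, rfl⟩

/-- The ghost lemma. -/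
lemma comp_eq_zero {M : DerivedCategory (ModuleCat.{u} R)} (hM : gIter R n M)
    (hf : IsGhostComp (n + 1) f) (u : M ⟶ X) : u ≫ f = 0 := by
  induction n generalizing M X with
  | zero =>
    obtain ⟨W, a, b, ha, -, rfl⟩ := hf
    rw [← Category.assoc, ha M hM, zero_comp]
  | succ n ih =>
    obtain ⟨W, a, b, ha, hb, rfl⟩ := hf
    obtain ⟨K, L, N, k, l, h, H, hK, hN⟩ := (triangEnvelopeIter_succ_iff _ n M).1 hM
    obtain ⟨v, hv⟩ := IsTri.desc H (biprod.snd ≫ u ≫ a) (by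
      rw [← Category.assoc, ← Category.assoc, Category.assoc k]
      exact ha K hK _)
    have h₁ : (biprod.snd ≫ u ≫ a) ≫ b = (0 : L ⊞ M ⟶ _) := by
      rw [← hv, Category.assoc, ih hN hb v, comp_zero]
    have h₂ := congr(biprod.inr ≫ $h₁)
    simpa using h₂

end IsGhostComp

section

variable {K G N Q : ModuleCat.{u} R} {i : K ⟶ G} {p : G ⟶ N}
  {δ : single N ⟶ (single K)⟦(1 : ℤ)⟧}

/-- Maps `G'⟦n⟧ ⟶ N` vanish for `n > 0` by degrees; for `n ≤ 0` the composite lies in `Ext^(1 -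
n)(G', K) = 0`. -/
lemma isGhost_to_shift {m : ℕ} (hK : HasPdLE m K) (δ : single N ⟶ (single K)⟦(1 : ℤ)⟧) :
    IsGhost δ := by
  refine isGhost_of_shift fun G' hG' n u => ?_
  by_cases hn : 0 < n
  · have := TStructure.t.isLE_shift (single G') 0 n (-n)
    have := TStructure.t.isLE_of_le ((single G')⟦n⟧) (-n) (-1)
    rw [hom_eq_zero_of_isLE u, zero_comp]
  · let e : (single G')⟦n⟧⟦-n⟧ ≅ single G' := shiftShiftNeg _ n
    let e' := (shiftFunctorAdd' (DerivedCategory (ModuleCat.{u} R)) 1 (-n) (1 - n)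
      (by lia)).app (single K)
    have h := hom_eq_zero_of_isGP hG'.isGP hK (n := 1 - n) (by lia)
      (e.inv ≫ (u ≫ δ)⟦-n⟧' ≫ e'.inv)
    apply (shiftFunctor _ (-n)).map_injective
    rw [← cancel_epi e.inv, ← cancel_mono e'.inv, Category.assoc, h]
    simp

/-- If `δ ≫ f⟦1⟧` vanished, `f` would extend to `G ⟶ Q⟦n⟧`, which is zero because `G` is Gorenstein
projective and `n > 0`. -/
lemma IsSES.exists_isGhostComp (hS : IsSES i p) (hG : IsGP G) {m : ℕ} (hK : HasPdLE m K)
    (hQ : Projective Q) {n : ℤ} (hn : 0 < n) {f : single K ⟶ (single Q)⟦n⟧} (hf : f ≠ 0) {k : ℕ}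
    (hf' : IsGhostComp k f) :
    ∃ g : single N ⟶ (single Q)⟦n + 1⟧, g ≠ 0 ∧ IsGhostComp (k + 1) g := by
  obtain ⟨δ, hδ⟩ := hS.exists_isTri
  let e := (shiftFunctorAdd (DerivedCategory (ModuleCat.{u} R)) n 1).app (single Q)
  refine ⟨δ ≫ f⟦(1 : ℤ)⟧' ≫ e.inv, ?_, _, δ, _, isGhost_to_shift hK δ, (hf'.shift 1).comp _, rfl⟩
  intro h
  have h' : δ ≫ f⟦(1 : ℤ)⟧' = 0 := by
    rw [← cancel_mono e.inv, Category.assoc, h, zero_comp]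
  obtain ⟨v, hv⟩ := hδ.rotate.desc₃ _ h'
  obtain ⟨v, rfl⟩ := (shiftFunctor _ (1 : ℤ)).map_surjective v
  rw [hom_projective_eq_zero_of_isGP hG hQ hn v, Functor.map_zero, comp_zero] at hv
  exact hf ((shiftFunctor _ (1 : ℤ)).map_injective (by rw [← hv, Functor.map_zero]))

end

/-- The composite of all connecting maps of a projective resolution. It starts with a non-split
sequence, since a splitting would make that syzygy projective. -/
lemma HasPdLE.exists_isGhostComp {m : ℕ} {K : ModuleCat.{u} R} (hK : HasPdLE (m + 1) K)
    (hK' : ¬ HasPdLE m K) :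
    ∃ (Q : ModuleCat.{u} R) (n : ℤ) (f : single K ⟶ (single Q)⟦n⟧), Projective Q ∧ 0 < n ∧
      f ≠ 0 ∧ IsGhostComp (m + 1) f := by
  induction m generalizing K with
  | zero =>
    obtain ⟨L, P, i, p, hS, ⟨hP, hP'⟩, hL⟩ := hK
    obtain ⟨δ, hδ⟩ := hS.exists_isTri
    refine ⟨L, 1, δ, hL.1, one_pos, ?_, _, δ, 𝟙 _, isGhost_to_shift hL δ, trivial,
      Category.comp_id δ⟩
    rintro rfl
    obtain ⟨s, hs⟩ := hδ.lift₃ (𝟙 _) comp_zero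
    obtain ⟨s, rfl⟩ := (singleFunctor (ModuleCat.{u} R) 0).map_surjective s
    have hsp : s ≫ p = 𝟙 K := (singleFunctor (ModuleCat.{u} R) 0).map_injective (by
      rw [Functor.map_comp, hs, CategoryTheory.Functor.map_id])
    exact hK' ⟨Retract.projective ⟨s, p, hsp⟩ , Module.Finite.of_surjective p.hom hS.surj⟩
  | succ m ih =>
    obtain ⟨L, P, i, p, hS, hP, hL⟩ := hK
    obtain ⟨Q, n, f, hQ, hn, hf, hf'⟩ := ih hL fun h => hK' ⟨L, P, i, p, hS, hP, h⟩
    have := hP.1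
    obtain ⟨g, hg, hg'⟩ := hS.exists_isGhostComp (.of_projective P) hL hQ hn hf hf'
    exact ⟨Q, n + 1, g, hQ, by lia, hg, hg'⟩

lemma hasGdimLE_of_gIter [IsNoetherianRing R] {n : ℕ} {N : ModuleCat.{u} R} [Module.Finite R N]
    (h : gIter R (n + 1) (single N)) : HasGdimLE (n + 1) N := by
  classical
  have h' := exists_hasGdimLE_of_gIter h
  by_contra hn
  -- The exact dimension is `m + 2 ≥ n + 2`; the approximation then yields a nonzero product of `m +
  -- 2` ghosts out of `N`, while `n + 2` ghosts already compose to zero.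
  have hlt : n + 1 < Nat.find h' := by
    by_contra hle
    exact hn ((Nat.find_spec h').mono (not_lt.1 hle))
  obtain ⟨m, hm⟩ := Nat.exists_eq_add_of_le' (show 2 ≤ Nat.find h' by lia)
  have h₁ : HasGdimLE (m + 2) N := hm ▸ Nat.find_spec h'
  have h₂ : ¬ HasGdimLE (m + 1) N := Nat.find_min h' (by lia)
  obtain ⟨K, G, i, p, hS, hK, hG⟩ := h₁.exists_approximation
  obtain ⟨Q, k, f, hQ, hk, hf, hf'⟩ := hK.exists_isGhostComp fun hK' =>
    h₂ (.succ hS hG hK'.hasGdimLE)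
  obtain ⟨g, hg, hg'⟩ := hS.exists_isGhostComp hG.isGP hK hQ hk hf hf'
  refine hg ?_
  rw [← Category.id_comp g]
  exact (hg'.mono (by lia)).comp_eq_zero h _

end Ghost

/-! ### Comparison of the numerical invariants. -/

section Main

open DerivedCategory

variable {R : Type u} [CommRing R] [HasDerivedCategory.{w} (ModuleCat.{u} R)]

lemma iInf_eq_top_or_exists (p : ℕ → Prop) (f : ℕ → ℕ∞) :
    ⨅ (n : ℕ) (_ : p n), f n = ⊤ ∨ ∃ n, p n ∧ ⨅ (n : ℕ) (_ : p n), f n = f n := by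
  have h : ⨅ (n : ℕ) (_ : p n), f n = sInf (f '' {n | p n}) := sInf_image.symm
  rw [h]
  by_cases hp : ∃ n, p n
  · obtain ⟨n, hn, h'⟩ := csInf_mem (Set.Nonempty.image f (s := {n | p n}) hp)
    exact .inr ⟨n, hn, h'.symm⟩
  · left
    rw [show {n | p n} = ∅ from Set.eq_empty_of_forall_notMem fun n hn => hp ⟨n, hn⟩]
    simp

lemma gLevel_le {M : DerivedCategory (ModuleCat.{u} R)} {n : ℕ} (h : gIter R n M) :
    gLevel M ≤ ((n + 1 : ℕ) : ℕ∞) := by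
  unfold gLevel level
  split_ifs
  · exact zero_le
  · exact iInf₂_le n h

lemma finite_homologySum {M : DerivedCategory (ModuleCat.{u} R)} (hM : IsDbf M) :
    Module.Finite R (homologySum M) := by
  classical
  obtain ⟨⟨⟨a, ha⟩, ⟨b, hb⟩⟩, hM⟩ := hM
  have ha : M.IsGE a := ha
  have hb : M.IsLE b := hb
  refine ⟨?_⟩
  have h : (⊤ : Submodule R (DirectSum ℤ fun i => (homologyFunctor (ModuleCat.{u} R) i).obj M)) =
      ⨆ i ∈ Finset.Icc a b, LinearMap.range
        (DirectSum.lof R ℤ (fun i => (homologyFunctor (ModuleCat.{u} R) i).obj M) i) := by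
    refine (eq_top_iff.2 fun x _ => ?_).symm
    induction x using DirectSum.induction_on with
    | zero => exact zero_mem _
    | of i x =>
      by_cases hi : i ∈ Finset.Icc a b
      · exact Submodule.mem_iSup_of_mem i (Submodule.mem_iSup_of_mem hi ⟨x, rfl⟩)
      · have h0 : IsZero ((homologyFunctor (ModuleCat.{u} R) i).obj M) := by
          rw [Finset.mem_Icc, not_and_or, not_le, not_le] at hi
          obtain hi | hi := hi
          · exact M.isZero_of_isGE a i hi
          · exact M.isZero_of_isLE b i hi
        have := ModuleCat.subsingleton_of_isZero h0
        rw [Subsingleton.elim x 0, map_zero]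
        exact zero_mem _
    | add x y hx hy => exact add_mem (hx trivial) (hy trivial)
  change (⊤ : Submodule R (DirectSum ℤ fun i => (homologyFunctor (ModuleCat.{u} R) i).obj M)).FG
  rw [h]
  refine Submodule.fg_biSup _ _ fun i _ => ?_
  have := hM i
  exact Module.Finite.iff_fg.1 inferInstance

lemma HasGdimLE.homology [IsNoetherianRing R] {M : DerivedCategory (ModuleCat.{u} R)} {n : ℕ}
    (h : HasGdimLE n (homologySum M)) (i : ℤ) : HasGdimLE n ((homologyFunctor _ i).obj M) := by
  classical
  refine h.of_retract (ModuleCat.ofHom (DirectSum.lof R ℤ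
      (fun i => (homologyFunctor (ModuleCat.{u} R) i).obj M) i))
    (ModuleCat.ofHom (DirectSum.component R ℤ
      (fun i => (homologyFunctor (ModuleCat.{u} R) i).obj M) i)) ?_
  ext x
  exact DirectSum.component.lof_self (R := R)
    (M := fun i => (homologyFunctor (ModuleCat.{u} R) i).obj M) i x

lemma gLevel_le_of_hasGdimLE [IsNoetherianRing R] {M : DerivedCategory (ModuleCat.{u} R)}
    (hM : IsDbf M) {n : ℕ} (h : HasGdimLE n (homologySum M)) :
    gLevel M ≤ max 2 ((n : ℕ∞) + 1) := by
  obtain ⟨d, hd, hnd⟩ : ∃ d, n ≤ d + 1 ∧ ((d + 1 + 1 : ℕ) : ℕ∞) ≤ max 2 ((n : ℕ∞) + 1) := by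
    -- Truncated subtraction treats `n = 0` like `n = 1`; the bound 2 in the maximum absorbs the
    -- difference.
    refine ⟨n - 1, by lia, ?_⟩
    rcases n with _ | n
    · simp
    · exact le_max_of_le_right (by simp)
  exact (gLevel_le (gIter_of_homology M hM.1 fun i => (h.mono hd).homology i)).trans hnd

/-- The level of a nonzero finitely generated module and its Gorenstein dimension. -/
lemma max_gdim_eq_max_gLevel [IsNoetherianRing R] {N : ModuleCat.{u} R} [Module.Finite R N]
    (hN : ¬ IsZero N) :
    max 2 ((⨅ (n : ℕ) (_ : HasGdimLE n N), (n : ℕ∞)) + 1) = max 2 (gLevel (single N)) := by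
  have hle {n : ℕ} (h : HasGdimLE n N) : (⨅ (n : ℕ) (_ : HasGdimLE n N), (n : ℕ∞)) ≤ n :=
    iInf₂_le n h
  apply le_antisymm
  · refine max_le (le_max_left _ _) ?_
    have h0 : ¬ IsZero (single N) := fun h => hN <| by
      rw [IsZero.iff_id_eq_zero] at h ⊢
      apply (singleFunctor (ModuleCat.{u} R) 0).map_injective
      rw [CategoryTheory.Functor.map_id, h, Functor.map_zero]
    unfold gLevel level
    rw [if_neg h0]
    obtain h | ⟨n, hn, h⟩ := iInf_eq_top_or_exists (fun n => gIter R n (single N))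
      (fun n => ((n + 1 : ℕ) : ℕ∞))
    · rw [h]
      simp
    · rw [h]
      rcases n with _ | n
      · have h₁ : gIter R 1 (single N) :=
          ObjectProperty.monotone'_triangEnvelopeIter _ zero_le_one _ hn
        refine le_max_of_le_left ?_
        calc _ ≤ ((1 : ℕ) : ℕ∞) + 1 := add_le_add_left (hle (hasGdimLE_of_gIter h₁)) 1
          _ ≤ 2 := by norm_num
      · refine le_max_of_le_right ?_
        rw [Nat.cast_add (n + 1) 1]
        exact add_le_add_left (hle (hasGdimLE_of_gIter hn)) 1
  · refine max_le (le_max_left _ _) (le_max_of_le_right ?_)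
    obtain h | ⟨n, hn, h⟩ := iInf_eq_top_or_exists (fun n => HasGdimLE n N) (fun n => (n : ℕ∞))
    · rw [h]
      simp
    · rw [h]
      exact_mod_cast gLevel_le (gIter_of_hasGdimLE hn)

end Main

end GLevel

theorem mainTheorem5 {R : Type u} [CommRing R] [IsNoetherianRing R]
    [HasDerivedCategory.{w} (ModuleCat.{u} R)]
    (M : DerivedCategory (ModuleCat.{u} R)) (hM : GLevel.IsDbf M) :
    (GLevel.gLevel M : WithBot ℕ∞) ≤ max 2 (GLevel.gdim (GLevel.homologySum M) + 1) ∧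
      max 2 (GLevel.gdim (GLevel.homologySum M) + 1) =
        ((max 2 (GLevel.gLevel (GLevel.single (GLevel.homologySum M))) : ℕ∞) : WithBot ℕ∞) := by
  have := GLevel.finite_homologySum hM
  by_cases h : IsZero (GLevel.homologySum M)
  · have h₁ : GLevel.HasGdimLE 0 (GLevel.homologySum M) :=
      GLevel.HasGdimLE.of_iso ((ModuleCat.isZero_of_subsingleton _).iso h)
        (GLevel.fgGorensteinProjective_punit (R := R))
    have h₂ := GLevel.gLevel_le_of_hasGdimLE hM h₁
    have h₃ : GLevel.gLevel (GLevel.single (GLevel.homologySum M)) = 0 :=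
      if_pos (Functor.map_isZero _ h)
    have h₄ : GLevel.gdim (GLevel.homologySum M) = ⊥ := if_pos h
    rw [h₃, h₄, WithBot.bot_add, max_eq_left bot_le]
    refine ⟨WithBot.coe_le_coe.2 (h₂.trans ?_), by simp⟩
    exact max_le le_rfl (by norm_num)
  · have h₁ : GLevel.gdim (GLevel.homologySum M) =
        ((⨅ (n : ℕ) (_ : GLevel.HasGdimLE n (GLevel.homologySum M)), (n : ℕ∞) : ℕ∞) :
          WithBot ℕ∞) := if_neg h
    rw [← GLevel.max_gdim_eq_max_gLevel h, h₁]
    have h₂ (a : ℕ∞) : max 2 ((a : WithBot ℕ∞) + 1) = ((max 2 (a + 1) : ℕ∞) : WithBot ℕ∞) :=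
      (WithBot.coe_max 2 (a + 1)).symm
    refine ⟨?_, h₂ _⟩
    rw [h₂, WithBot.coe_le_coe]
    obtain h₃ | ⟨n, hn, h₃⟩ := GLevel.iInf_eq_top_or_exists
      (fun n => GLevel.HasGdimLE n (GLevel.homologySum M)) (fun n => (n : ℕ∞))
    · rw [h₃]
      simp
    · rw [h₃]
      exact GLevel.gLevel_le_of_hasGdimLE hM hn
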